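/- Let $K$ be a finite extension of $\mathbb{Q}_p$ with absolute value $|\cdot|$ extending the $p$-adic one, ring of integers $R$ and residue field $k$. Let $$\mathbb{T}^{\dagger}_n=\Big\{\sum_{v\in\mathbb{N}^n}c_v\xi^v\in R[[\xi_1,\dots,\xi_n]] : \exists\,\varepsilon>0,\ |c_v|\,p^{\varepsilon|v|}\to 0\Big\}.$$ A weakly complete finitely generated (w.c.f.g.) $R$-algebra is a homomorphic image of some $\mathbb{T}^{\dagger}_n$. Let $A=\mathbb{T}^{\dagger}_n/I$ be a w.c.f.g. $R$-algebra that is flat over $R$. Put $A\langle\xi\rangle^{\dagger}=\mathbb{T}^{\dagger}_{n+1}/I\,\mathbb{T}^{\dagger}_{n+1}$, where $\xi$ is the additional variable, and for $f\in A$ put $A\langle f^{-1}\rangle^{\dagger}=A\langle\xi\rangle^{\dagger}/(f\xi-1)$. If $f$ divides $g=fh$ in $A$, the substitution $\xi\mapsto h\xi$ induces a homomorphism of $A$-algebras $A\langle f^{-1}\rangle^{\dagger}\to A\langle g^{-1}\rangle^{\dagger}$. Let $X$ be the topological space $\operatorname{Spec}(A\otimes_R k)$, write $\bar f=f\otimes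 1$ for $f\in A$, and let $X_{\bar f}\subseteq X$ be the basic open set where $\bar f\neq 0$. For $x\in X$ let $\mathcal{O}^{\dagger}_x=\varinjlim_{\bar f\notin x}A\langle f^{-1}\rangle^{\dagger}$. For $U\subseteq X$ open, let $\mathcal{O}^{\dagger}(U)$ be the $A$-algebra of functions $s:U\to\coprod_{x\in U}\mathcal{O}^{\dagger}_x$ with $s(x)\in\mathcal{O}^{\dagger}_x$ such that for each $x\in U$ there are $f\in A$ with $\bar f\notin x$ and $a\in A\langle f^{-1}\rangle^{\dagger}$ such that $s(y)$ is the image of $a$ in $\mathcal{O}^{\dagger}_y$ for all $y\in X_{\bar f}\cap U$. The pair $(X,\mathcal{O}^{\dagger})$ is $\mathrm{Spf}^{\dagger}(A)$. Then for every $f\in A$ the canonical homomorphism of $A$-algebras $A\langle f^{-1}\rangle^{\dagger}\to\mathcal{O}^{\dagger}(X_{\bar f})$, sending $a$ to the function $x\mapsto(\text{image of }a\text{ in }\mathcal{O}^{\dagger}_x)$, is an isomorphism. In particular, the canonical homomorphism $A\to\mathcal{O}^{\dagger}(X)$ is an isomorphism. -/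

import Mathlib

open scoped TensorProduct

noncomputable section

namespace Dagger

/-! ### The ring of integers and the overconvergent power series algebras -/

/-- The ring of integers `R = {x ∈ K : |x| ≤ 1}` of a nonarchimedean field `K`; it inherits the
absolute value of `K`. -/
abbrev IntegerRing (K : Type*) [NormedField K] [IsUltrametricDist K] : ValuationSubring K :=
  (NormedField.valuation (K := K)).valuationSubring

theorem norm_le_one {K : Type*} [NormedField K] [IsUltrametricDist K] (x : IntegerRing K) :
    ‖x‖ ≤ 1 := by
  have h : NormedField.valuation (x : K) ≤ 1 := x.2
  exact h

section Overconvergent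

variable {R : Type*} [NormedCommRing R]

/-- `∃ ρ > 1, |c_v| ρ^{|v|} → 0`, for `F = ∑ c_v ξ^v` (that is `ρ = p ^ ε` with `ε > 0`). -/
def IsOverconvergent {σ : Type*} (F : MvPowerSeries σ R) : Prop :=
  ∃ ρ : ℝ, 1 < ρ ∧ MvPowerSeries.IsRestricted (fun _ => ρ) F

/-- `|c_v| ρ^{|v|} ≤ C` for all `v`. -/
def Bd {σ : Type*} (ρ C : ℝ) (F : MvPowerSeries σ R) : Prop :=
  ∀ v : σ →₀ ℕ, ‖MvPowerSeries.coeff v F‖ * ρ ^ v.degree ≤ C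

theorem prod_eq_pow_degree {σ : Type*} (ρ : ℝ) (v : σ →₀ ℕ) :
    v.prod (fun _ k => ρ ^ k) = ρ ^ v.degree := by
  rw [Finsupp.prod, Finset.prod_pow_eq_pow_sum]; rfl

theorem Bd.mono {σ : Type*} {ρ ρ' C C' : ℝ} {F : MvPowerSeries σ R} (h : Bd ρ C F)
    (h0 : 0 ≤ ρ') (hρ : ρ' ≤ ρ) (hC : C ≤ C') : Bd ρ' C' F := fun v =>
  ((mul_le_mul_of_nonneg_left (pow_le_pow_left₀ h0 hρ _) (norm_nonneg _)).trans (h v)).trans hC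

theorem Bd.add {σ : Type*} [IsUltrametricDist R] {ρ C : ℝ} {F G : MvPowerSeries σ R} (h0 : 0 ≤ ρ)
    (hF : Bd ρ C F) (hG : Bd ρ C G) : Bd ρ C (F + G) := by
  intro v
  rw [map_add]
  rcases le_max_iff.1 (IsUltrametricDist.norm_add_le_max (MvPowerSeries.coeff v F)
    (MvPowerSeries.coeff v G)) with h | h
  · exact (mul_le_mul_of_nonneg_right h (pow_nonneg h0 _)).trans (hF v)
  · exact (mul_le_mul_of_nonneg_right h (pow_nonneg h0 _)).trans (hG v)

theorem Bd.zero {σ : Type*} {ρ C : ℝ} (hC : 0 ≤ C) : Bd ρ C (0 : MvPowerSeries σ R) := by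
  intro v; simpa using hC

theorem Bd.sum {σ ι : Type*} [IsUltrametricDist R] {ρ C : ℝ} (h0 : 0 ≤ ρ) (hC : 0 ≤ C) (s : Finset ι)
    (F : ι → MvPowerSeries σ R) (h : ∀ i ∈ s, Bd ρ C (F i)) : Bd ρ C (∑ i ∈ s, F i) := by
  classical
  induction s using Finset.induction_on with
  | empty => simpa using Bd.zero hC
  | insert a s ha ih =>
    rw [Finset.sum_insert ha]
    exact (h a (by simp)).add h0 (ih fun i hi => h i (by simp [hi]))

theorem Bd.mul {σ : Type*} [IsUltrametricDist R] {ρ C C' : ℝ} {F G : MvPowerSeries σ R} (h0 : 0 < ρ) (hC : 0 ≤ C)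
    (hC' : 0 ≤ C') (hF : Bd ρ C F) (hG : Bd ρ C' G) : Bd ρ (C * C') (F * G) := by
  classical
  intro v
  rw [← le_div_iff₀ (pow_pos h0 _), MvPowerSeries.coeff_mul]
  refine IsUltrametricDist.norm_sum_le_of_forall_le_of_nonneg (by positivity) fun x hx => ?_
  rw [le_div_iff₀ (pow_pos h0 _), ← Finset.HasAntidiagonal.mem_antidiagonal.1 hx, map_add, pow_add]
  calc ‖MvPowerSeries.coeff x.1 F * MvPowerSeries.coeff x.2 G‖ *
        (ρ ^ x.1.degree * ρ ^ x.2.degree)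
      ≤ (‖MvPowerSeries.coeff x.1 F‖ * ‖MvPowerSeries.coeff x.2 G‖) *
        (ρ ^ x.1.degree * ρ ^ x.2.degree) := by gcongr; exact norm_mul_le _ _
    _ = (‖MvPowerSeries.coeff x.1 F‖ * ρ ^ x.1.degree) *
        (‖MvPowerSeries.coeff x.2 G‖ * ρ ^ x.2.degree) := by ring
    _ ≤ C * C' := mul_le_mul (hF _) (hG _) (by positivity) hC

theorem Bd.one {σ : Type*} [NormOneClass R] {ρ : ℝ} : Bd ρ 1 (1 : MvPowerSeries σ R) := by
  classical
  intro v
  rw [MvPowerSeries.coeff_one]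
  split_ifs with h
  · simp [h]
  · simp

theorem Bd.pow {σ : Type*} [IsUltrametricDist R] [NormOneClass R] {ρ C : ℝ} {F : MvPowerSeries σ R} (h0 : 0 < ρ)
    (hC : 0 ≤ C) (hF : Bd ρ C F) (j : ℕ) : Bd ρ (C ^ j) (F ^ j) := by
  induction j with
  | zero => simpa using Bd.one
  | succ j ih => rw [pow_succ, pow_succ]; exact ih.mul h0 (pow_nonneg hC _) hC hF

theorem IsOverconvergent.exists_bd {σ : Type*} {F : MvPowerSeries σ R}
    (h : IsOverconvergent F) : ∃ ρ C : ℝ, 1 < ρ ∧ 0 ≤ C ∧ Bd ρ C F := by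
  obtain ⟨ρ, hρ, hF⟩ := h
  obtain ⟨C, hC⟩ := hF.bddAbove_range_of_cofinite
  have hb : Bd ρ C F := fun v => by
    have := hC ⟨v, rfl⟩
    dsimp only at this
    rwa [prod_eq_pow_degree] at this
  refine ⟨ρ, C, hρ, le_trans ?_ (hb 0), hb⟩
  positivity

theorem Bd.isOverconvergent {σ : Type*} [Finite σ] {ρ C : ℝ} (hρ : 1 < ρ)
    {F : MvPowerSeries σ R} (h : Bd ρ C F) : IsOverconvergent F := by
  have h1 : 1 < Real.sqrt ρ := by rw [Real.lt_sqrt (by norm_num)]; simpa using hρ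
  have h0 : 0 < Real.sqrt ρ := by linarith
  refine ⟨Real.sqrt ρ, h1, ?_⟩
  have hd : Filter.Tendsto (fun v : σ →₀ ℕ => v.degree) Filter.cofinite Filter.atTop := by
    rw [Filter.tendsto_atTop]
    intro b
    rw [Filter.eventually_cofinite]
    refine (Finsupp.finite_of_degree_le (σ := σ) b).subset fun v hv => ?_
    exact (not_le.1 hv).le
  have hlim : Filter.Tendsto (fun v : σ →₀ ℕ => C * (Real.sqrt ρ)⁻¹ ^ v.degree)
      Filter.cofinite (nhds 0) := by
    have := ((tendsto_pow_atTop_nhds_zero_of_lt_one (inv_nonneg.2 h0.le)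
      (inv_lt_one_of_one_lt₀ h1)).comp hd).const_mul C
    simpa using this
  refine squeeze_zero (fun v => ?_) (fun v => ?_) hlim
  · rw [prod_eq_pow_degree]; positivity
  · rw [prod_eq_pow_degree, inv_pow, ← div_eq_mul_inv, le_div_iff₀ (pow_pos h0 _), mul_assoc,
      ← mul_pow, Real.mul_self_sqrt (by linarith)]
    exact h v

/-- A power series over `R` with coefficients of absolute value at most `1` that is overconvergent
has Gauss norms close to `1` on small enough neighbourhoods of the closed unit polydisc. -/
theorem IsOverconvergent.exists_bd_lt {σ : Type*} (hR : ∀ x : R, ‖x‖ ≤ 1)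
    {F : MvPowerSeries σ R} (h : IsOverconvergent F) {D : ℝ} (hD : 1 < D) :
    ∃ ρ : ℝ, 1 < ρ ∧ Bd ρ D F := by
  obtain ⟨ρ₀, hρ₀, hF⟩ := h
  have hfin : {v : σ →₀ ℕ | ¬ ‖MvPowerSeries.coeff v F‖ * v.prod (fun _ k => ρ₀ ^ k) < 1}.Finite :=
    Filter.eventually_cofinite.1 (hF.eventually (gt_mem_nhds one_pos))
  obtain ⟨N, hN⟩ := (hfin.image Finsupp.degree).bddAbove
  have hlim : ∀ᶠ x : ℝ in nhdsWithin 1 (Set.Ioi 1), x ^ N < D := by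
    have : Filter.Tendsto (fun x : ℝ => x ^ N) (nhdsWithin 1 (Set.Ioi 1)) (nhds 1) := by
      have := ((continuous_pow N).tendsto (1 : ℝ)).mono_left
        (nhdsWithin_le_nhds (s := Set.Ioi (1 : ℝ)))
      simpa using this
    exact this.eventually (gt_mem_nhds hD)
  obtain ⟨ρ, h1, h2, h3⟩ := (hlim.and
    ((Ioo_mem_nhdsGT hρ₀ : Set.Ioo 1 ρ₀ ∈ nhdsWithin (1 : ℝ) (Set.Ioi 1)))).exists
  refine ⟨ρ, h2, fun v => ?_⟩
  by_cases hv : ‖MvPowerSeries.coeff v F‖ * v.prod (fun _ k => ρ₀ ^ k) < 1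
  · rw [prod_eq_pow_degree] at hv
    refine le_trans ?_ (hv.le.trans hD.le)
    gcongr
  · have hle : v.degree ≤ N := hN ⟨v, hv, rfl⟩
    calc ‖MvPowerSeries.coeff v F‖ * ρ ^ v.degree ≤ 1 * ρ ^ N := by
          gcongr
          · exact hR _
          · exact h2.le
      _ ≤ D := by rw [one_mul]; exact h1.le

variable (R) in
/-- `𝕋†_n`: the power series `∑ c_v ξ^v ∈ R⟦ξ_1, …, ξ_n⟧` such that `|c_v| ρ^{|v|} → 0` for
some `ρ > 1`. -/
def Tdag [IsUltrametricDist R] (n : ℕ) : Subalgebra R (MvPowerSeries (Fin n) R) where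
  carrier := {F | IsOverconvergent F}
  mul_mem' {F G} hF hG := by
    obtain ⟨ρ, C, hρ, hC, h⟩ := IsOverconvergent.exists_bd hF
    obtain ⟨ρ', C', hρ', hC', h'⟩ := IsOverconvergent.exists_bd hG
    have hm : 1 < min ρ ρ' := lt_min hρ hρ'
    have h0 : 0 < min ρ ρ' := by linarith
    exact ((h.mono h0.le (min_le_left _ _) le_rfl).mul h0 hC hC'
      (h'.mono h0.le (min_le_right _ _) le_rfl)).isOverconvergent hm
  add_mem' {F G} hF hG := by
    obtain ⟨ρ, C, hρ, hC, h⟩ := IsOverconvergent.exists_bd hF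
    obtain ⟨ρ', C', hρ', hC', h'⟩ := IsOverconvergent.exists_bd hG
    have hm : 1 < min ρ ρ' := lt_min hρ hρ'
    have h0 : 0 < min ρ ρ' := by linarith
    exact ((h.mono h0.le (min_le_left _ _) (le_max_left _ _)).add h0.le
      (h'.mono h0.le (min_le_right _ _) (le_max_right _ _))).isOverconvergent hm
  algebraMap_mem' r := by
    refine ⟨2, one_lt_two, ?_⟩
    exact MvPowerSeries.isRestricted_C _ r

theorem mem_Tdag [IsUltrametricDist R] {n : ℕ} {F : MvPowerSeries (Fin n) R} : F ∈ Tdag R n ↔ IsOverconvergent F :=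
  Iff.rfl

theorem degree_cons {n : ℕ} (k : ℕ) (v : Fin n →₀ ℕ) : (v.cons k).degree = k + v.degree := by
  simp [Finsupp.degree_eq_sum, Fin.sum_univ_succ]

/-- Multiplying the coefficients `F_j` of an overconvergent series `F = ∑ F_j ξ^j` by overconvergent
series `H_j` of subexponential growth gives an overconvergent series. -/
theorem twist_mem [IsUltrametricDist R] {n : ℕ} {F : MvPowerSeries (Fin (n + 1)) R} (hF : F ∈ Tdag R (n + 1))
    (H : ℕ → MvPowerSeries (Fin n) R)
    (hH : ∀ D : ℝ, 1 < D → ∃ ρ : ℝ, 1 < ρ ∧ ∀ j, Bd ρ (D ^ j) (H j)) :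
    (MvPowerSeries.finSuccEquiv R n).symm (PowerSeries.mk fun j =>
      H j * PowerSeries.coeff j (MvPowerSeries.finSuccEquiv R n F)) ∈ Tdag R (n + 1) := by
  obtain ⟨s, C, hs, hC, hb⟩ := IsOverconvergent.exists_bd hF
  set D := Real.sqrt s with hDdef
  have hD : 1 < D := by rw [hDdef, Real.lt_sqrt (by norm_num)]; simpa using hs
  have hDD : D * D = s := Real.mul_self_sqrt (by linarith)
  obtain ⟨ρ, hρ, hH⟩ := hH D hD
  have hm : 1 < min ρ D := lt_min hρ hD
  have h0 : 0 < min ρ D := by linarith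
  have hDs : D ≤ s := by nlinarith
  refine Bd.isOverconvergent (ρ := min ρ D) (C := C) hm fun w => ?_
  obtain ⟨j, v, rfl⟩ : ∃ j v, w = Finsupp.cons j v := ⟨w 0, w.tail, (Finsupp.cons_tail w).symm⟩
  rw [← MvPowerSeries.coeff_coeff_finSuccEquiv, AlgEquiv.apply_symm_apply, PowerSeries.coeff_mk]
  have hFj : Bd s (C / s ^ j)
      (PowerSeries.coeff j (MvPowerSeries.finSuccEquiv R n F)) := fun u => by
    have := hb (u.cons j)
    rw [degree_cons, pow_add] at this
    rw [MvPowerSeries.coeff_coeff_finSuccEquiv, le_div_iff₀ (by positivity)]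
    calc _ = _ := by ring
      _ ≤ C := this
  have hmul := ((hH j).mono h0.le (min_le_left _ _) le_rfl).mul h0 (by positivity)
    (by positivity) (hFj.mono h0.le ((min_le_right _ _).trans hDs) le_rfl) v
  rw [degree_cons, pow_add]
  calc _ = (‖MvPowerSeries.coeff v (H j * PowerSeries.coeff j
          (MvPowerSeries.finSuccEquiv R n F))‖ * min ρ D ^ v.degree) * min ρ D ^ j := by ring
    _ ≤ (D ^ j * (C / s ^ j)) * D ^ j := by
        gcongr
        exact min_le_right _ _
    _ = C := by
        rw [← hDD, mul_pow]
        field_simp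

end Overconvergent

variable {K : Type*} [NormedField K] [IsUltrametricDist K]

/-! ### Adjoining one more variable, and rescaling it -/

/-- The variable `ξ` of `𝕋†_{n+1}` that is adjoined to `𝕋†_n` (variable number `0`). -/
def newVar (K : Type*) [NormedField K] [IsUltrametricDist K] (n : ℕ) :
    Tdag (IntegerRing K) (n + 1) :=
  ⟨MvPowerSeries.X 0, 2, one_lt_two, MvPowerSeries.isRestricted_monomial _ _ _⟩

theorem bd_C {n : ℕ} {ρ C : ℝ} (hC : 0 ≤ C) {F : MvPowerSeries (Fin n) (IntegerRing K)}
    (h : Bd ρ C F) :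
    Bd ρ C ((MvPowerSeries.finSuccEquiv (IntegerRing K) n).symm (PowerSeries.C F)) := by
  intro w
  obtain ⟨j, v, rfl⟩ : ∃ j v, w = Finsupp.cons j v := ⟨w 0, w.tail, (Finsupp.cons_tail w).symm⟩
  rw [← MvPowerSeries.coeff_coeff_finSuccEquiv, AlgEquiv.apply_symm_apply, PowerSeries.coeff_C,
    degree_cons]
  split_ifs with hj
  · simpa [hj] using h v
  · simpa using hC

/-- The inclusion `𝕋†_n → 𝕋†_{n+1}`: a series in `n` variables, as one not involving `ξ`. -/
def incl (K : Type*) [NormedField K] [IsUltrametricDist K] (n : ℕ) :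
    Tdag (IntegerRing K) n →+* Tdag (IntegerRing K) (n + 1) :=
  RingHom.codRestrict
    ((((MvPowerSeries.finSuccEquiv (IntegerRing K) n).symm : _ →+* _).comp PowerSeries.C).comp
      (Tdag (IntegerRing K) n).subtype)
    (Tdag (IntegerRing K) (n + 1)) fun F => by
      obtain ⟨ρ, C, hρ, hC, h⟩ := IsOverconvergent.exists_bd F.2
      exact (bd_C hC h).isOverconvergent hρ

theorem pow_growth {n : ℕ} (h : Tdag (IntegerRing K) n) (D : ℝ) (hD : 1 < D) :
    ∃ ρ : ℝ, 1 < ρ ∧ ∀ j, Bd ρ (D ^ j) ((h : MvPowerSeries (Fin n) (IntegerRing K)) ^ j) := by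
  obtain ⟨ρ, hρ, hb⟩ := IsOverconvergent.exists_bd_lt norm_le_one h.2 hD
  exact ⟨ρ, hρ, fun j => hb.pow (by linarith) (by linarith) j⟩

theorem geom_growth {n : ℕ} (h h' : Tdag (IntegerRing K) n) (D : ℝ) (hD : 1 < D) :
    ∃ ρ : ℝ, 1 < ρ ∧ ∀ j, Bd ρ (D ^ j) (∑ i ∈ Finset.range j,
      (h : MvPowerSeries (Fin n) (IntegerRing K)) ^ i *
        (h' : MvPowerSeries (Fin n) (IntegerRing K)) ^ (j - 1 - i)) := by
  obtain ⟨ρ, hρ, hb⟩ := pow_growth h D hD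
  obtain ⟨ρ', hρ', hb'⟩ := pow_growth h' D hD
  have hm : 1 < min ρ ρ' := lt_min hρ hρ'
  have h0 : 0 < min ρ ρ' := by linarith
  have hD0 : 0 ≤ D := by linarith
  refine ⟨min ρ ρ', hm, fun j => Bd.sum h0.le (by positivity) _ _ fun i hi => ?_⟩
  have hi' := Finset.mem_range.1 hi
  refine (Bd.mul h0 (by positivity) (by positivity) ((hb i).mono h0.le (min_le_left _ _) le_rfl)
    ((hb' (j - 1 - i)).mono h0.le (min_le_right _ _) le_rfl)).mono h0.le le_rfl ?_
  rw [← pow_add]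
  exact pow_le_pow_right₀ hD.le (by omega)

theorem rescale_mem {n : ℕ} (h : Tdag (IntegerRing K) n) (F : Tdag (IntegerRing K) (n + 1)) :
    (MvPowerSeries.finSuccEquiv (IntegerRing K) n).symm
      (PowerSeries.rescale (h : MvPowerSeries (Fin n) (IntegerRing K))
        (MvPowerSeries.finSuccEquiv (IntegerRing K) n F)) ∈ Tdag (IntegerRing K) (n + 1) := by
  have : PowerSeries.rescale (h : MvPowerSeries (Fin n) (IntegerRing K))
      (MvPowerSeries.finSuccEquiv (IntegerRing K) n F) = PowerSeries.mk fun j =>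
        (h : MvPowerSeries (Fin n) (IntegerRing K)) ^ j *
          PowerSeries.coeff j (MvPowerSeries.finSuccEquiv (IntegerRing K) n F) := by
    ext j : 1
    rw [PowerSeries.coeff_rescale, PowerSeries.coeff_mk]
  rw [this]
  exact twist_mem F.2 _ (pow_growth h)

/-- The substitution `ξ ↦ h ξ`, as an endomorphism of `𝕋†_{n+1}` fixing `𝕋†_n`:
`∑ F_j ξ^j ↦ ∑ h^j F_j ξ^j`, for `h ∈ 𝕋†_n`. -/
def scale {n : ℕ} (h : Tdag (IntegerRing K) n) :
    Tdag (IntegerRing K) (n + 1) →+* Tdag (IntegerRing K) (n + 1) where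
  toFun F := ⟨(MvPowerSeries.finSuccEquiv (IntegerRing K) n).symm
    (PowerSeries.rescale (h : MvPowerSeries (Fin n) (IntegerRing K))
      (MvPowerSeries.finSuccEquiv (IntegerRing K) n F)), rescale_mem h F⟩
  map_one' := Subtype.ext (by simp only [OneMemClass.coe_one, map_one])
  map_zero' := Subtype.ext (by simp only [ZeroMemClass.coe_zero, map_zero])
  map_mul' F G := Subtype.ext (by simp only [MulMemClass.coe_mul, map_mul])
  map_add' F G := Subtype.ext (by simp only [AddMemClass.coe_add, map_add])

theorem scale_coe {n : ℕ} (h : Tdag (IntegerRing K) n) (F : Tdag (IntegerRing K) (n + 1)) :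
    MvPowerSeries.finSuccEquiv (IntegerRing K) n (scale h F) =
      PowerSeries.rescale (h : MvPowerSeries (Fin n) (IntegerRing K))
        (MvPowerSeries.finSuccEquiv (IntegerRing K) n F) :=
  AlgEquiv.apply_symm_apply _ _

theorem incl_coe {n : ℕ} (F : Tdag (IntegerRing K) n) :
    MvPowerSeries.finSuccEquiv (IntegerRing K) n (incl K n F) =
      PowerSeries.C (F : MvPowerSeries (Fin n) (IntegerRing K)) :=
  AlgEquiv.apply_symm_apply _ _

theorem newVar_coe {n : ℕ} :
    MvPowerSeries.finSuccEquiv (IntegerRing K) n (newVar K n) = PowerSeries.X :=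
  MvPowerSeries.finSuccEquiv_X_zero

theorem ext_finSucc {n : ℕ} {F G : Tdag (IntegerRing K) (n + 1)}
    (h : MvPowerSeries.finSuccEquiv (IntegerRing K) n F =
      MvPowerSeries.finSuccEquiv (IntegerRing K) n G) : F = G :=
  Subtype.ext ((MvPowerSeries.finSuccEquiv (IntegerRing K) n).injective h)

theorem scale_incl {n : ℕ} (h F : Tdag (IntegerRing K) n) :
    scale h (incl K n F) = incl K n F := by
  refine ext_finSucc ?_
  rw [scale_coe, incl_coe]
  ext j : 1
  rw [PowerSeries.coeff_rescale, PowerSeries.coeff_C]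
  split_ifs with hj <;> simp [hj]

theorem scale_newVar {n : ℕ} (h : Tdag (IntegerRing K) n) :
    scale h (newVar K n) = incl K n h * newVar K n := by
  refine ext_finSucc ?_
  rw [scale_coe, newVar_coe, PowerSeries.rescale_X]
  simp only [MulMemClass.coe_mul, map_mul, incl_coe, newVar_coe]

theorem scale_one {n : ℕ} (F : Tdag (IntegerRing K) (n + 1)) : scale 1 F = F := by
  refine ext_finSucc ?_
  rw [scale_coe]
  simp [PowerSeries.rescale_one]

theorem scale_scale {n : ℕ} (h h' : Tdag (IntegerRing K) n) (F : Tdag (IntegerRing K) (n + 1)) :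
    scale h' (scale h F) = scale (h * h') F := by
  refine ext_finSucc ?_
  simp only [scale_coe, PowerSeries.rescale_rescale, MulMemClass.coe_mul]

theorem dvd_scale_sub {n : ℕ} (h h' : Tdag (IntegerRing K) n)
    (F : Tdag (IntegerRing K) (n + 1)) :
    incl K n (h - h') ∣ scale h F - scale h' F := by
  refine ⟨⟨_, twist_mem F.2 _ (geom_growth h h')⟩, ext_finSucc ?_⟩
  simp only [MulMemClass.coe_mul, map_mul, incl_coe, AddSubgroupClass.coe_sub, map_sub, scale_coe,
    AlgEquiv.apply_symm_apply]
  rw [← map_sub]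
  ext j : 1
  rw [PowerSeries.coeff_C_mul, PowerSeries.coeff_mk, map_sub, PowerSeries.coeff_rescale,
    PowerSeries.coeff_rescale, ← sub_mul, ← geom_sum₂_mul]
  ring

/-! ### Weakly complete finitely generated algebras and their localizations -/

/-- A presentation of the `R`-algebra `A` as a homomorphic image of some `𝕋†_n`. -/
structure Presentation (K : Type*) [NormedField K] [IsUltrametricDist K]
    (A : Type*) [CommRing A] [Algebra (IntegerRing K) A] where
  /-- the number of variables -/
  n : ℕ
  /-- the homomorphism onto `A` -/
  toHom : Tdag (IntegerRing K) n →ₐ[IntegerRing K] A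
  surjective : Function.Surjective toHom

variable {A : Type*} [CommRing A] [Algebra (IntegerRing K) A] (P : Presentation K A)

/-- `A⟨ξ⟩†` is `𝕋†_{n+1} / I 𝕋†_{n+1}`, where `A = 𝕋†_n / I`. -/
def Adjoin : Type _ :=
  Tdag (IntegerRing K) (P.n + 1) ⧸ (RingHom.ker P.toHom).map (incl K P.n)

instance : CommRing (Adjoin P) := inferInstanceAs (CommRing (_ ⧸ _))

/-- The projection `𝕋†_{n+1} → A⟨ξ⟩†`. -/
def Adjoin.mk : Tdag (IntegerRing K) (P.n + 1) →+* Adjoin P :=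
  Ideal.Quotient.mk ((RingHom.ker P.toHom).map (incl K P.n))

theorem Adjoin.mk_surjective : Function.Surjective (Adjoin.mk P) := Ideal.Quotient.mk_surjective

/-- The structure map `A → A⟨ξ⟩†`, induced by `𝕋†_n → 𝕋†_{n+1}`. -/
def Adjoin.ofBase : A →+* Adjoin P :=
  RingHom.liftOfSurjective (P.toHom : Tdag (IntegerRing K) P.n →+* A) P.surjective
    ⟨(Adjoin.mk P).comp (incl K P.n), fun _ hx =>
      Ideal.Quotient.eq_zero_iff_mem.2 (Ideal.mem_map_of_mem _ hx)⟩

instance : Algebra A (Adjoin P) := (Adjoin.ofBase P).toAlgebra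

theorem Adjoin.algebraMap_toHom (t : Tdag (IntegerRing K) P.n) :
    algebraMap A (Adjoin P) (P.toHom t) = Adjoin.mk P (incl K P.n t) :=
  RingHom.liftOfRightInverse_comp_apply (P.toHom : Tdag (IntegerRing K) P.n →+* A) _ _
    ⟨(Adjoin.mk P).comp (incl K P.n), fun _ hx =>
      Ideal.Quotient.eq_zero_iff_mem.2 (Ideal.mem_map_of_mem _ hx)⟩ t

/-- The element `ξ` of `A⟨ξ⟩†`. -/
def Adjoin.xi : Adjoin P := Adjoin.mk P (newVar K P.n)

/-- `A⟨f⁻¹⟩† = A⟨ξ⟩† / (f ξ - 1)`. -/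
def Loc (f : A) : Type _ :=
  Adjoin P ⧸ Ideal.span {algebraMap A (Adjoin P) f * Adjoin.xi P - 1}

instance (f : A) : CommRing (Loc P f) := inferInstanceAs (CommRing (_ ⧸ _))

instance (f : A) : Algebra A (Loc P f) := inferInstanceAs (Algebra A (_ ⧸ _))

/-- The projection `A⟨ξ⟩† → A⟨f⁻¹⟩†`. -/
def Loc.mk (f : A) : Adjoin P →ₐ[A] Loc P f :=
  Ideal.Quotient.mkₐ A (Ideal.span {algebraMap A (Adjoin P) f * Adjoin.xi P - 1})

theorem Loc.mk_surjective (f : A) : Function.Surjective (Loc.mk P f) :=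
  Ideal.Quotient.mk_surjective

theorem Loc.algebraMap_mul_xi (f : A) :
    algebraMap A (Loc P f) f * Loc.mk P f (Adjoin.xi P) = 1 := by
  have : Loc.mk P f (algebraMap A (Adjoin P) f * Adjoin.xi P - 1) = 0 :=
    Ideal.Quotient.eq_zero_iff_mem.2 (Ideal.subset_span rfl)
  rw [map_sub, map_mul, AlgHom.commutes, map_one] at this
  exact sub_eq_zero.1 this

/-- The endomorphism `ξ ↦ h ξ` of the `A`-algebra `A⟨ξ⟩†`, for the image `h` in `A` of
`t ∈ 𝕋†_n`. -/
def Adjoin.scale (t : Tdag (IntegerRing K) P.n) : Adjoin P →ₐ[A] Adjoin P where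
  toRingHom := Ideal.Quotient.lift _ ((Adjoin.mk P).comp (Dagger.scale t)) fun a ha => by
    have hle : (RingHom.ker P.toHom).map (incl K P.n) ≤
        RingHom.ker ((Adjoin.mk P).comp (Dagger.scale t)) := by
      rw [Ideal.map_le_iff_le_comap]
      intro x hx
      rw [Ideal.mem_comap, RingHom.mem_ker, RingHom.comp_apply, scale_incl]
      exact Ideal.Quotient.eq_zero_iff_mem.2 (Ideal.mem_map_of_mem _ hx)
    exact hle ha
  commutes' a := by
    obtain ⟨x, rfl⟩ := P.surjective a
    rw [Adjoin.algebraMap_toHom]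
    change Adjoin.mk P (Dagger.scale t (incl K P.n x)) = _
    rw [scale_incl]

theorem Adjoin.scale_mk (t : Tdag (IntegerRing K) P.n) (F : Tdag (IntegerRing K) (P.n + 1)) :
    Adjoin.scale P t (Adjoin.mk P F) = Adjoin.mk P (Dagger.scale t F) := rfl

theorem Adjoin.scale_xi (t : Tdag (IntegerRing K) P.n) :
    Adjoin.scale P t (Adjoin.xi P) = algebraMap A (Adjoin P) (P.toHom t) * Adjoin.xi P := by
  rw [Adjoin.xi, Adjoin.scale_mk, scale_newVar, map_mul, Adjoin.algebraMap_toHom]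

/-- In `A⟨g⁻¹⟩†`, where `g = f h`, the substitution `ξ ↦ h ξ` depends only on `f` and `g`. -/
theorem Loc.mk_scale_eq {f g : A} (hg : f ∣ g) {t t' : Tdag (IntegerRing K) P.n}
    (ht : f * P.toHom t = g) (ht' : f * P.toHom t' = g) (a : Adjoin P) :
    Loc.mk P g (Adjoin.scale P t a) = Loc.mk P g (Adjoin.scale P t' a) := by
  obtain ⟨F, rfl⟩ := Adjoin.mk_surjective P a
  obtain ⟨c, hc⟩ := hg
  have h0 : algebraMap A (Loc P g) (P.toHom (t - t')) = 0 := by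
    have h1 : f * P.toHom (t - t') = 0 := by rw [map_sub, mul_sub, ht, ht', sub_self]
    have h2 : g * P.toHom (t - t') = 0 := by
      rw [hc, mul_right_comm, h1, zero_mul]
    calc algebraMap A (Loc P g) (P.toHom (t - t'))
        = (algebraMap A (Loc P g) g * Loc.mk P g (Adjoin.xi P)) *
            algebraMap A (Loc P g) (P.toHom (t - t')) := by
          rw [Loc.algebraMap_mul_xi, one_mul]
      _ = algebraMap A (Loc P g) (g * P.toHom (t - t')) * Loc.mk P g (Adjoin.xi P) := by
          rw [map_mul]; ring
      _ = 0 := by rw [h2, map_zero, zero_mul]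
  obtain ⟨Q, hQ⟩ := dvd_scale_sub t t' F
  rw [Adjoin.scale_mk, Adjoin.scale_mk, ← sub_eq_zero, ← map_sub, ← map_sub, hQ, map_mul,
    ← Adjoin.algebraMap_toHom, map_mul, AlgHom.commutes, h0, zero_mul]

/-- A chosen `t ∈ 𝕋†_n` whose image `h` in `A` satisfies `f h = g`. -/
def cofactor {f g : A} (h : f ∣ g) : Tdag (IntegerRing K) P.n :=
  Function.surjInv P.surjective h.choose

theorem cofactor_spec {f g : A} (h : f ∣ g) : f * P.toHom (cofactor P h) = g := by
  rw [cofactor, Function.surjInv_eq P.surjective]; exact h.choose_spec.symm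

/-- The restriction map `A⟨f⁻¹⟩† → A⟨g⁻¹⟩†` for `g = f h`: the `A`-algebra homomorphism induced
by `ξ ↦ h ξ`. -/
def Loc.res {f g : A} (h : f ∣ g) : Loc P f →ₐ[A] Loc P g :=
  Ideal.Quotient.liftₐ _ ((Loc.mk P g).comp (Adjoin.scale P (cofactor P h))) fun a ha => by
    have hle : Ideal.span {algebraMap A (Adjoin P) f * Adjoin.xi P - 1} ≤
        RingHom.ker ((Loc.mk P g).comp (Adjoin.scale P (cofactor P h))) := by
      rw [Ideal.span_le, Set.singleton_subset_iff]
      change (Loc.mk P g).comp (Adjoin.scale P (cofactor P h)) _ = 0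
      rw [AlgHom.comp_apply, map_sub, map_mul, AlgHom.commutes, Adjoin.scale_xi, ← mul_assoc,
        ← map_mul, cofactor_spec, map_one, map_sub, map_mul, AlgHom.commutes, map_one,
        Loc.algebraMap_mul_xi, sub_self]
    exact hle ha

theorem Loc.res_mk {f g : A} (h : f ∣ g) (a : Adjoin P) :
    Loc.res P h (Loc.mk P f a) = Loc.mk P g (Adjoin.scale P (cofactor P h) a) := rfl

theorem Loc.res_self {f : A} (h : f ∣ f) (a : Loc P f) : Loc.res P h a = a := by
  obtain ⟨a, rfl⟩ := Loc.mk_surjective P f a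
  rw [Loc.res_mk, Loc.mk_scale_eq P h (cofactor_spec P h) (t' := 1) (by simp)]
  obtain ⟨F, rfl⟩ := Adjoin.mk_surjective P a
  rw [Adjoin.scale_mk, scale_one]

theorem Loc.res_res {f g e : A} (h : f ∣ g) (h' : g ∣ e) (a : Loc P f) :
    Loc.res P h' (Loc.res P h a) = Loc.res P (h.trans h') a := by
  obtain ⟨a, rfl⟩ := Loc.mk_surjective P f a
  obtain ⟨F, rfl⟩ := Adjoin.mk_surjective P a
  rw [Loc.res_mk, Loc.res_mk, Loc.res_mk, Loc.mk_scale_eq P (h.trans h')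
    (cofactor_spec P (h.trans h')) (t' := cofactor P h * cofactor P h')
    (by rw [map_mul, ← mul_assoc, cofactor_spec, cofactor_spec]),
    Adjoin.scale_mk, Adjoin.scale_mk, Adjoin.scale_mk, scale_scale]

/-! ### The affine dagger formal scheme `Spf†(A)` -/

variable (K A) in
/-- The underlying topological space of `Spf†(A)`: that of `Spec (A ⊗_R k)`. -/
abbrev SpfSpace : Type _ :=
  PrimeSpectrum (A ⊗[IntegerRing K] IsLocalRing.ResidueField (IntegerRing K))

variable (K) in
/-- The reduction `f̄ = f ⊗ 1 ∈ A ⊗_R k` of `f ∈ A`. -/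
def reduction (f : A) : A ⊗[IntegerRing K] IsLocalRing.ResidueField (IntegerRing K) :=
  f ⊗ₜ[IntegerRing K] 1

theorem reduction_mul (f g : A) : reduction K (f * g) = reduction K f * reduction K g := by
  simp [reduction]

theorem reduction_one : reduction K (1 : A) = 1 := rfl

variable (K) in
/-- The basic open set `X_f̄` of `X = Spf†(A)`. -/
abbrev basicOpen (f : A) : TopologicalSpace.Opens (SpfSpace K A) :=
  PrimeSpectrum.basicOpen (reduction K f)

/-- The `f ∈ A` with `f̄ ∉ x`. -/
def Nbhd (x : SpfSpace K A) : Type _ := {f : A // x ∈ basicOpen K f}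

/-- The index set of the stalk is directed by divisibility. -/
instance (x : SpfSpace K A) : Preorder (Nbhd x) where
  le f g := f.1 ∣ g.1
  le_refl f := dvd_refl f.1
  le_trans _ _ _ h h' := dvd_trans h h'

instance (x : SpfSpace K A) : Nonempty (Nbhd x) := ⟨⟨1, by simp [basicOpen, reduction_one]⟩⟩

theorem mem_basicOpen_mul {x : SpfSpace K A} {f g : A} (hf : x ∈ basicOpen K f)
    (hg : x ∈ basicOpen K g) : x ∈ basicOpen K (f * g) := by
  rw [basicOpen, reduction_mul, PrimeSpectrum.basicOpen_mul]
  exact ⟨hf, hg⟩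

theorem mem_basicOpen_mul_iff {x : SpfSpace K A} {f g : A} :
    x ∈ basicOpen K (f * g) ↔ x ∈ basicOpen K f ∧ x ∈ basicOpen K g := by
  rw [basicOpen, reduction_mul, PrimeSpectrum.basicOpen_mul]
  exact Iff.rfl

instance (x : SpfSpace K A) : IsDirectedOrder (Nbhd x) where
  directed f g := ⟨⟨f.1 * g.1, mem_basicOpen_mul f.2 g.2⟩, dvd_mul_right f.1 g.1,
    dvd_mul_left g.1 f.1⟩

instance (x : SpfSpace K A) : DirectedSystem (fun f : Nbhd x => Loc P f.1)
    fun _ _ h => Loc.res P h where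
  map_self _ a := Loc.res_self P _ a
  map_map _ _ _ h h' a := Loc.res_res P h h' a

/-- The stalk `𝒪†_x`, the direct limit of `A⟨f⁻¹⟩†` over the `f ∈ A` with `f̄ ∉ x`. -/
def Stalk (x : SpfSpace K A) : Type _ :=
  DirectLimit (fun f : Nbhd x => Loc P f.1) fun f g (h : f ≤ g) => Loc.res P (f := f.1) (g := g.1) h

instance (x : SpfSpace K A) : CommRing (Stalk P x) :=
  inferInstanceAs (CommRing (DirectLimit (fun f : Nbhd x => Loc P f.1)
    fun f g (h : f ≤ g) => Loc.res P (f := f.1) (g := g.1) h))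

instance (x : SpfSpace K A) : Algebra A (Stalk P x) :=
  inferInstanceAs (Algebra A (DirectLimit (fun f : Nbhd x => Loc P f.1)
    fun f g (h : f ≤ g) => Loc.res P (f := f.1) (g := g.1) h))

/-- The canonical map `A⟨f⁻¹⟩† → 𝒪†_x`, for `f̄ ∉ x`. -/
def germ (f : A) (x : SpfSpace K A) (hx : x ∈ basicOpen K f) : Loc P f →ₐ[A] Stalk P x :=
  DirectLimit.Algebra.of (R := A) (fun f : Nbhd x => Loc P f.1)
    (fun f g (h : f ≤ g) => Loc.res P (f := f.1) (g := g.1) h) ⟨f, hx⟩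

theorem germ_res {f g : A} (h : f ∣ g) (x : SpfSpace K A) (hf : x ∈ basicOpen K f)
    (hg : x ∈ basicOpen K g) (a : Loc P f) : germ P g x hg (Loc.res P h a) = germ P f x hf a :=
  DirectLimit.Algebra.of_f (R := A) (G := fun f : Nbhd x => Loc P f.1)
    (f := fun f g (h : f ≤ g) => Loc.res P (f := f.1) (g := g.1) h)
    (i := (⟨f, hf⟩ : Nbhd x)) (j := (⟨g, hg⟩ : Nbhd x)) h a

/-- The sections `𝒪†(U)`: the functions `s` on `U` with `s(x) ∈ 𝒪†_x` such that every point of `U`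
has a neighbourhood `X_f̄` on which `s` is given by an element of `A⟨f⁻¹⟩†`. Sections are added and
multiplied pointwise, and are restricted as functions. -/
def structureSheaf (U : TopologicalSpace.Opens (SpfSpace K A)) :
    Subalgebra A (∀ x : U, Stalk P (x : SpfSpace K A)) where
  carrier := {s | ∀ x : U, ∃ f : A, (x : SpfSpace K A) ∈ basicOpen K f ∧ ∃ a : Loc P f,
    ∀ (y : U) (hy : (y : SpfSpace K A) ∈ basicOpen K f), s y = germ P f y hy a}
  mul_mem' {s t} hs ht x := by
    obtain ⟨f, hf, a, ha⟩ := hs x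
    obtain ⟨g, hg, b, hb⟩ := ht x
    refine ⟨f * g, mem_basicOpen_mul hf hg, Loc.res P (dvd_mul_right f g) a *
      Loc.res P (dvd_mul_left g f) b, fun y hy => ?_⟩
    obtain ⟨hyf, hyg⟩ := mem_basicOpen_mul_iff.1 hy
    rw [map_mul, germ_res P _ _ hyf, germ_res P _ _ hyg, Pi.mul_apply, ha y hyf, hb y hyg]
  add_mem' {s t} hs ht x := by
    obtain ⟨f, hf, a, ha⟩ := hs x
    obtain ⟨g, hg, b, hb⟩ := ht x
    refine ⟨f * g, mem_basicOpen_mul hf hg, Loc.res P (dvd_mul_right f g) a +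
      Loc.res P (dvd_mul_left g f) b, fun y hy => ?_⟩
    obtain ⟨hyf, hyg⟩ := mem_basicOpen_mul_iff.1 hy
    rw [map_add, germ_res P _ _ hyf, germ_res P _ _ hyg, Pi.add_apply, ha y hyf, hb y hyg]
  algebraMap_mem' r x := ⟨1, by simp [basicOpen, reduction_one], algebraMap A _ r, fun y hy => by
    rw [AlgHom.commutes]; rfl⟩

/-- The canonical homomorphism `A⟨f⁻¹⟩† → 𝒪†(X_f̄)`, sending `a` to the function `x ↦ a_x`. -/
def toSections (f : A) : Loc P f →ₐ[A] structureSheaf P (basicOpen K f) :=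
  AlgHom.codRestrict (AlgHom.pi fun x : basicOpen K f => germ P f x x.2)
    (structureSheaf P (basicOpen K f)) fun a x => ⟨f, x.2, a, fun _ _ => rfl⟩

end Dagger

end

/-!
Modulo a power `ϖ^N` of a uniformizer, `A⟨f⁻¹⟩†` is the ordinary localization `(A / ϖ^N)_f`
(`Loc.exists_pow_mul_dvd`, `Loc.exists_pow_mul_sub_dvd`), so that the assertion holds modulo every
power of `ϖ` by the usual arguments for affine schemes. Two things have to be added: that the
algebras in question are `ϖ`-adically separated, and that the `ϖ`-adic limit of sections glued
modulo `ϖ^N` is overconvergent. Both follow from estimates of Gauss norms at radii `ρ > 1` close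
to `1`.

The source of the estimates is a division algorithm. Let `ψ : 𝕋†_m → B` be surjective, with `B /
ϖ^N` flat over `R / ϖ^N` for all `N`. A Gröbner basis for the graded lexicographic order of the
image of `ker ψ + (ϖ)` in the polynomial ring `𝕋†_m / ϖ` lifts to elements `f_i` of `ker ψ`, and
division by the `f_i` modulo `ϖ` does not raise degrees (`exists_division_step`). If `ρ` is so
close to `1` that the `f_i` have Gauss norm at most `D`, then writing `F ∈ ker ψ + (ϖ^N)` as a sum
of an element of `ker ψ` and `ϖ^N t` costs no more than a factor `(D / |ϖ|)^N` in the norm of `t`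
(`FlatPresentation.exists_division`). As `D` can be taken arbitrarily close to `1`, while a series
`∑ ϖ^k H_k` is overconvergent as soon as the norms of the `H_k` grow no faster than `|ϖ|^{-2k}`
(`exists_tsum`), two consequences result: `B` is separated
(`FlatPresentation.eq_zero_of_forall_pow_dvd`), and a Cauchy sequence in `B` converges if it has
representatives of norm at most `C E^N` with `E < |ϖ|⁻¹` (`FlatPresentation.exists_limit`). This
applies to `A⟨f⁻¹⟩†` without knowing that it is flat over `R`, as its reductions are localizations
of those of `A`.

Injectivity is then the local nature of vanishing modulo `ϖ^N`. For surjectivity, sections `s_i`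
over the `g_i`, which generate the unit ideal of `A⟨f⁻¹⟩†`, are multiplied modulo `ϖ^N` by
`g_i^d`, to become elements `q_i` of `A` with `g_j^d q_i = g_i^d q_j`, and `∑ b_i q_i` is the
glued section if `∑ b_i g_i^d = 1`. Here `d` may be taken linear in `N`, because overconvergent
series are modulo `ϖ^N` polynomials of degree linear in `N` (`exists_pow_dvd_xiCoeff`), and
because the `g`-torsion of `A / ϖ^N` is killed by `g^{eN}` for some `e` (`exists_torsion_bound`).
Therefore the glued sections satisfy the growth condition (`exists_approx_glue`), and they
converge.
-/

noncomputable section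

namespace Dagger

/-! ### Uniformizers -/

section Uniformizer

variable {K : Type*} [NormedField K] [IsUltrametricDist K]

/-- A uniformizer of `R`, described by the absolute value: a nonzero element of the maximal ideal
of largest absolute value. -/
structure IsUnif (ϖ : IntegerRing K) : Prop where
  pos : 0 < ‖ϖ‖
  lt_one : ‖ϖ‖ < 1
  le : ∀ x : IntegerRing K, ‖x‖ < 1 → ‖x‖ ≤ ‖ϖ‖

/-- In a proper field, the open unit ball is closed, hence compact, so the absolute value attains
its maximum there. -/
theorem exists_isUnif [ProperSpace K] (h : ∃ x : K, x ≠ 0 ∧ ‖x‖ < 1) :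
    ∃ ϖ : IntegerRing K, IsUnif ϖ := by
  have hc : IsCompact (Metric.ball (0 : K) 1) :=
    (isCompact_closedBall (0 : K) 1).of_isClosed_subset (IsUltrametricDist.isClosed_ball 0 1)
      Metric.ball_subset_closedBall
  obtain ⟨x, hx, hmax⟩ := hc.exists_isMaxOn ⟨0, by simp⟩ continuous_norm.continuousOn
  obtain ⟨y, hy0, hy1⟩ := h
  have hx1 : ‖x‖ < 1 := by simpa using hx
  refine ⟨⟨x, show NormedField.valuation x ≤ 1 from hx1.le⟩, ?_, hx1, fun z hz => ?_⟩
  · exact lt_of_lt_of_le (norm_pos_iff.2 hy0)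
      (hmax (by simpa using hy1 : y ∈ Metric.ball (0 : K) 1))
  · exact hmax (by simpa using hz : (z : K) ∈ Metric.ball (0 : K) 1)

theorem dvd_of_norm_le {x y : IntegerRing K} (hx : x ≠ 0) (h : ‖y‖ ≤ ‖x‖) : x ∣ y := by
  have hx' : (x : K) ≠ 0 := by simpa using hx
  refine ⟨⟨(y : K) / x, show NormedField.valuation ((y : K) / x) ≤ 1 from ?_⟩, ?_⟩
  · change ‖(y : K) / x‖ ≤ 1
    rw [norm_div]
    exact div_le_one_of_le₀ h (norm_nonneg _)
  · ext
    push_cast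
    field_simp

namespace IsUnif

variable {ϖ : IntegerRing K} (hϖ : IsUnif ϖ)
include hϖ

theorem ne_zero : ϖ ≠ 0 := norm_pos_iff.1 hϖ.pos

theorem pow_dvd_iff {N : ℕ} {x : IntegerRing K} : ϖ ^ N ∣ x ↔ ‖x‖ ≤ ‖ϖ‖ ^ N := by
  constructor
  · rintro ⟨y, rfl⟩
    rw [norm_mul, norm_pow]
    exact mul_le_of_le_one_right (by positivity) (norm_le_one y)
  · intro h
    exact dvd_of_norm_le (pow_ne_zero _ hϖ.ne_zero) (by rwa [norm_pow])

theorem dvd_iff_lt {x : IntegerRing K} : ϖ ∣ x ↔ ‖x‖ < 1 := by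
  have := hϖ.pow_dvd_iff (N := 1) (x := x)
  rw [pow_one, pow_one] at this
  rw [this]
  exact ⟨fun h => h.trans_lt hϖ.lt_one, hϖ.le x⟩

theorem mem_maximalIdeal_iff {x : IntegerRing K} :
    x ∈ IsLocalRing.maximalIdeal (IntegerRing K) ↔ ϖ ∣ x := by
  rw [hϖ.dvd_iff_lt, IsLocalRing.mem_maximalIdeal, mem_nonunits_iff]
  constructor
  · intro h
    refine lt_of_le_of_ne (norm_le_one x) fun h1 => h ?_
    have hx : x ≠ 0 := by rintro rfl; simp at h1
    exact isUnit_of_dvd_one (dvd_of_norm_le hx (by rw [h1, norm_one]))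
  · rintro h ⟨u, rfl⟩
    have h1 : ‖(u : IntegerRing K)‖ * ‖((u⁻¹ : (IntegerRing K)ˣ) : IntegerRing K)‖ = 1 := by
      rw [← norm_mul, Units.mul_inv, norm_one]
    nlinarith [norm_le_one ((u⁻¹ : (IntegerRing K)ˣ) : IntegerRing K),
      norm_nonneg (u : IntegerRing K),
      norm_nonneg ((u⁻¹ : (IntegerRing K)ˣ) : IntegerRing K)]

theorem eq_zero_of_forall_norm_le {x : IntegerRing K} (h : ∀ N : ℕ, ‖x‖ ≤ ‖ϖ‖ ^ N) : x = 0 := by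
  have := le_of_tendsto_of_tendsto' tendsto_const_nhds
    (tendsto_pow_atTop_nhds_zero_of_lt_one (norm_nonneg ϖ) hϖ.lt_one) h
  exact norm_le_zero_iff.1 this

end IsUnif

end Uniformizer

/-! ### Divisibility by powers of the uniformizer, and infinite sums -/

section Tdag

variable {K : Type*} [NormedField K] [IsUltrametricDist K]

/-- The coefficient of `ξ^v` in an overconvergent series. -/
abbrev cf {m : ℕ} (v : Fin m →₀ ℕ) (F : Tdag (IntegerRing K) m) : IntegerRing K :=
  MvPowerSeries.coeff v (F : MvPowerSeries (Fin m) (IntegerRing K))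

/-- The constant series `r`. -/
abbrev cst (m : ℕ) (r : IntegerRing K) : Tdag (IntegerRing K) m := algebraMap _ _ r

theorem coeff_cst_pow_mul {m : ℕ} (r : IntegerRing K) (N : ℕ) (F : Tdag (IntegerRing K) m)
    (v : Fin m →₀ ℕ) : cf v (cst m r ^ N * F) = r ^ N * cf v F := by
  rw [← map_pow, ← Algebra.smul_def]
  simp [cf]

theorem Tdag_ext {m : ℕ} {F G : Tdag (IntegerRing K) m} (h : ∀ v, cf v F = cf v G) : F = G :=
  Subtype.ext (MvPowerSeries.ext h)

theorem cf_sub {m : ℕ} (F G : Tdag (IntegerRing K) m) (v : Fin m →₀ ℕ) :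
    cf v (F - G) = cf v F - cf v G := by simp [cf]

theorem cf_sum {m : ℕ} {ι : Type*} (s : Finset ι) (F : ι → Tdag (IntegerRing K) m)
    (v : Fin m →₀ ℕ) : cf v (∑ i ∈ s, F i) = ∑ i ∈ s, cf v (F i) := by
  simp [cf, AddSubmonoidClass.coe_finsetSum]

theorem Bd.neg {σ R : Type*} [NormedCommRing R] {ρ C : ℝ} {F : MvPowerSeries σ R}
    (hF : Bd ρ C F) : Bd ρ C (-F) := fun v => by
  simpa using hF v

theorem Bd.sub {σ R : Type*} [NormedCommRing R] [IsUltrametricDist R] {ρ C : ℝ}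
    {F G : MvPowerSeries σ R} (h0 : 0 ≤ ρ) (hF : Bd ρ C F) (hG : Bd ρ C G) :
    Bd ρ C (F - G) := by
  rw [sub_eq_add_neg]; exact hF.add h0 hG.neg

variable {ϖ : IntegerRing K}

/-- If `ϖ^N` divides all coefficients of `F`, the quotient is overconvergent, with Gauss norm
larger by the factor `|ϖ|^{-N}`. -/
theorem exists_eq_cst_pow_mul (hϖ : IsUnif ϖ) {m : ℕ} {F : Tdag (IntegerRing K) m} {N : ℕ}
    (h : ∀ v, ‖cf v F‖ ≤ ‖ϖ‖ ^ N) :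
    ∃ G : Tdag (IntegerRing K) m, F = cst m ϖ ^ N * G ∧
      ∀ ρ C : ℝ, Bd ρ C (F : MvPowerSeries (Fin m) (IntegerRing K)) →
        Bd ρ (C / ‖ϖ‖ ^ N) (G : MvPowerSeries (Fin m) (IntegerRing K)) := by
  choose g hg using fun v => hϖ.pow_dvd_iff.2 (h v)
  have hp : 0 < ‖ϖ‖ ^ N := pow_pos hϖ.pos N
  let G : MvPowerSeries (Fin m) (IntegerRing K) := g
  have hG : ∀ v, MvPowerSeries.coeff v G = g v := fun v => rfl
  have hb : ∀ ρ C : ℝ, Bd ρ C (F : MvPowerSeries (Fin m) (IntegerRing K)) →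
        Bd ρ (C / ‖ϖ‖ ^ N) G := by
    intro ρ C hF v
    have h1 := hF v
    rw [hG, le_div_iff₀ hp]
    change ‖cf v F‖ * _ ≤ C at h1
    rw [hg v, norm_mul, norm_pow] at h1
    linarith
  have hmem : G ∈ Tdag (IntegerRing K) m := by
    obtain ⟨ρ, C, hρ, -, hF⟩ := IsOverconvergent.exists_bd F.2
    exact (hb ρ C hF).isOverconvergent hρ
  refine ⟨⟨G, hmem⟩, Tdag_ext fun v => ?_, hb⟩
  rw [coeff_cst_pow_mul, hg v]
  rfl

theorem cst_pow_dvd_iff (hϖ : IsUnif ϖ) {m : ℕ} {F : Tdag (IntegerRing K) m} {N : ℕ} :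
    cst m ϖ ^ N ∣ F ↔ ∀ v, ‖cf v F‖ ≤ ‖ϖ‖ ^ N := by
  constructor
  · rintro ⟨G, rfl⟩ v
    rw [coeff_cst_pow_mul, ← hϖ.pow_dvd_iff]
    exact dvd_mul_right _ _
  · intro h
    obtain ⟨G, hG, -⟩ := exists_eq_cst_pow_mul hϖ h
    exact ⟨G, hG⟩

theorem eq_of_forall_cst_pow_dvd (hϖ : IsUnif ϖ) {m : ℕ} {F G : Tdag (IntegerRing K) m}
    (h : ∀ N, cst m ϖ ^ N ∣ F - G) : F = G := by
  refine Tdag_ext fun v => sub_eq_zero.1 (hϖ.eq_zero_of_forall_norm_le fun N => ?_)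
  rw [← cf_sub]
  exact (cst_pow_dvd_iff hϖ).1 (h N) v

/-- A series `∑ ϖ^k H_k` in which the Gauss norms of the `H_k` grow no faster than `|ϖ|^{-2k}`
converges `ϖ`-adically to an overconvergent series: interpolating between the bounds `|ϖ|^k` at
radius `1` and `C (q|ϖ|)^k` at radius `ρ` bounds all terms at radius `√ρ`. -/
theorem exists_tsum [CompleteSpace K] (hϖ : IsUnif ϖ) {m : ℕ} (H : ℕ → Tdag (IntegerRing K) m)
    {ρ C q : ℝ} (hρ : 1 < ρ) (hC : 0 ≤ C) (hq : 0 ≤ q) (hqϖ : q * ‖ϖ‖ ^ 2 ≤ 1)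
    (hH : ∀ k, Bd ρ (C * q ^ k) (H k : MvPowerSeries (Fin m) (IntegerRing K))) :
    ∃ S : Tdag (IntegerRing K) m, ∀ N,
      cst m ϖ ^ N ∣ S - ∑ k ∈ Finset.range N, cst m ϖ ^ k * H k := by
  have hterm : ∀ v k, ‖(ϖ : K) ^ k * (cf v (H k) : K)‖ ≤ ‖ϖ‖ ^ k := fun v k => by
    rw [norm_mul, norm_pow]
    exact mul_le_of_le_one_right (by positivity) (norm_le_one (cf v (H k)))
  have hsum : ∀ v, Summable fun k => (ϖ : K) ^ k * (cf v (H k) : K) := fun v =>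
    Summable.of_norm_bounded (summable_geometric_of_lt_one (norm_nonneg ϖ) hϖ.lt_one) (hterm v)
  have htail : ∀ v N, ‖∑' k, (ϖ : K) ^ (k + N) * (cf v (H (k + N)) : K)‖ ≤ ‖ϖ‖ ^ N := by
    intro v N
    refine (IsUltrametricDist.norm_tsum_le _).trans (ciSup_le fun k => (hterm v _).trans ?_)
    exact pow_le_pow_of_le_one (norm_nonneg ϖ) hϖ.lt_one.le (by omega)
  let S : MvPowerSeries (Fin m) (IntegerRing K) := fun v =>
    ⟨∑' k, (ϖ : K) ^ k * (cf v (H k) : K), show NormedField.valuation _ ≤ 1 by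
      have := htail v 0
      simp only [add_zero, pow_zero] at this
      exact this⟩
  have hS : ∀ v, ((MvPowerSeries.coeff v S : IntegerRing K) : K) =
    ∑' k, (ϖ : K) ^ k * (cf v (H k) : K) := fun v => rfl
  have h1 : 1 < Real.sqrt ρ := by rw [Real.lt_sqrt (by norm_num)]; simpa using hρ
  have hmem : S ∈ Tdag (IntegerRing K) m := by
    refine Bd.isOverconvergent h1 (C := Real.sqrt C) fun v => ?_
    rw [← le_div_iff₀ (by positivity)]
    change ‖((MvPowerSeries.coeff v S : IntegerRing K) : K)‖ ≤ _
    rw [hS]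
    refine (IsUltrametricDist.norm_tsum_le _).trans (ciSup_le fun k => ?_)
    rw [le_div_iff₀ (by positivity)]
    refine Real.le_sqrt_of_sq_le ?_
    have h2 := hterm v k
    have h3 : ‖(ϖ : K) ^ k * (cf v (H k) : K)‖ * ρ ^ v.degree ≤ C * (q * ‖ϖ‖) ^ k := by
      rw [norm_mul, norm_pow]
      have := mul_le_mul_of_nonneg_left (hH k v) (pow_nonneg (norm_nonneg ϖ) k)
      calc _ = ‖ϖ‖ ^ k * (‖MvPowerSeries.coeff v (H k : MvPowerSeries (Fin m) (IntegerRing K))‖ *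
              ρ ^ v.degree) := by
            rw [← mul_assoc]; rfl
        _ ≤ ‖ϖ‖ ^ k * (C * q ^ k) := this
        _ = _ := by rw [mul_pow]; ring
    have h4 : Real.sqrt ρ ^ v.degree * Real.sqrt ρ ^ v.degree = ρ ^ v.degree := by
      rw [← mul_pow, Real.mul_self_sqrt (by linarith)]
    set x := ‖(ϖ : K) ^ k * (cf v (H k) : K)‖
    calc (x * Real.sqrt ρ ^ v.degree) ^ 2 = x * (x * ρ ^ v.degree) := by rw [← h4]; ring
      _ ≤ ‖ϖ‖ ^ k * (C * (q * ‖ϖ‖) ^ k) := by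
        gcongr
      _ = C * (q * ‖ϖ‖ ^ 2) ^ k := by rw [mul_pow, mul_pow]; ring
      _ ≤ C * 1 := by
        gcongr
        exact pow_le_one₀ (by positivity) hqϖ
      _ = C := mul_one C
  refine ⟨⟨S, hmem⟩, fun N => (cst_pow_dvd_iff hϖ).2 fun v => ?_⟩
  rw [cf_sub, cf_sum]
  simp only [coeff_cst_pow_mul]
  have h5 := (hsum v).sum_add_tsum_nat_add N
  have h6 := htail v N
  have h7 : ((MvPowerSeries.coeff v S - ∑ i ∈ Finset.range N, ϖ ^ i * cf v (H i) :
      IntegerRing K) : K) = ∑' k, (ϖ : K) ^ (k + N) * (cf v (H (k + N)) : K) := by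
    push_cast
    rw [hS, ← h5]
    ring
  rw [← h7] at h6
  exact h6

end Tdag

/-! ### Degree-controlled bases of polynomial ideals -/

open MvPolynomial MonomialOrder in
/-- An ideal `𝔞` of `k[x_1, …, x_m]` has a finite basis (a Gröbner basis for the graded
lexicographic order) with respect to which every `p ∈ 𝔞` has coefficients of total degree at most
that of `p`. -/
theorem exists_degree_controlled_basis {k : Type*} [Field k] {m : ℕ}
    (𝔞 : Ideal (MvPolynomial (Fin m) k)) :
    ∃ (ι : Type) (_ : Fintype ι) (b : ι → MvPolynomial (Fin m) k), (∀ i, b i ∈ 𝔞) ∧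
      ∀ p ∈ 𝔞, ∃ h : ι → MvPolynomial (Fin m) k,
        p = ∑ i, b i * h i ∧ ∀ i, (h i).totalDegree ≤ p.totalDegree := by
  classical
  let Q : (Fin m →₀ ℕ) → Prop := fun v => ∃ p ∈ 𝔞, p ≠ 0 ∧ degLex.degree p = v
  -- Dickson's lemma
  have hfin : {v | Minimal Q v}.Finite :=
    WellQuasiOrderedLE.finite_of_isAntichain (setOfPred_minimal_antichain Q)
  choose b hb𝔞 hb0 hbdeg using fun i : {v | Minimal Q v} => i.2.prop
  have : Fintype {v | Minimal Q v} := hfin.fintype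
  refine ⟨{v | Minimal Q v}, inferInstance, b, hb𝔞, fun p hp => ?_⟩
  obtain ⟨g, r, hpr, hdeg, hr⟩ := degLex.div (b := b)
    (fun i => isUnit_iff_ne_zero.2 (leadingCoeff_ne_zero_iff.2 (hb0 i))) p
  have hlin : Finsupp.linearCombination (MvPolynomial (Fin m) k) b g = ∑ i, b i * g i := by
    rw [Finsupp.linearCombination_apply, Finsupp.sum_fintype _ _ (by simp)]
    exact Finset.sum_congr rfl fun i _ => by rw [smul_eq_mul, mul_comm]
  have hr0 : r = 0 := by
    by_contra h
    have hr𝔞 : r ∈ 𝔞 := by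
      rw [hlin] at hpr
      rw [← sub_eq_iff_eq_add'.2 hpr]
      exact 𝔞.sub_mem hp (𝔞.sum_mem fun i _ => 𝔞.mul_mem_right _ (hb𝔞 i))
    obtain ⟨v, hv, hmin⟩ := exists_minimal_le_of_wellFoundedLT Q (degLex.degree r)
      ⟨r, hr𝔞, h, rfl⟩
    exact hr _ (degLex.degree_mem_support h) ⟨v, hmin⟩ (by rw [hbdeg]; exact hv)
  refine ⟨g, by rw [hpr, hr0, add_zero, hlin], fun i => ?_⟩
  by_cases hg : g i = 0
  · simp [hg]
  · have h1 := degLex_totalDegree_monotone (hdeg i)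
    rw [totalDegree_mul_of_isDomain (hb0 i) hg] at h1
    omega

/-! ### Division by an ideal with torsion-free quotient -/

section Division

variable {K : Type*} [NormedField K] [IsUltrametricDist K] {ϖ : IntegerRing K}

theorem bd_of_degree_le {m : ℕ} {ρ : ℝ} (hρ : 1 ≤ ρ) {d : ℕ}
    {F : MvPowerSeries (Fin m) (IntegerRing K)}
    (h : ∀ v, d < v.degree → MvPowerSeries.coeff v F = 0) : Bd ρ (ρ ^ d) F := by
  intro v
  by_cases hv : d < v.degree
  · rw [h v hv, norm_zero, zero_mul]
    positivity
  · calc _ ≤ 1 * ρ ^ d := by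
          gcongr
          · exact norm_le_one _
          · omega
      _ = _ := one_mul _

theorem mem_Tdag_of_degree_le {m d : ℕ} {F : MvPowerSeries (Fin m) (IntegerRing K)}
    (h : ∀ v, d < v.degree → MvPowerSeries.coeff v F = 0) : F ∈ Tdag (IntegerRing K) m :=
  (bd_of_degree_le one_le_two h).isOverconvergent one_lt_two

/-- `ψ : 𝕋†_m → B` is surjective, and `B / ϖ^N` behaves like a flat `R / ϖ^N`-algebra: division by
`ϖ` is possible modulo powers of `ϖ`. Torsion-freeness of `B` itself is not part of the condition,
since it is not known a priori for `A⟨f⁻¹⟩†`. -/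
structure FlatPresentation (ϖ : IntegerRing K) {m : ℕ} {B : Type*} [CommRing B]
    (ψ : Tdag (IntegerRing K) m →+* B) : Prop where
  surj : Function.Surjective ψ
  tors : ∀ (N : ℕ) (b : B), ψ (cst m ϖ) ^ (N + 1) ∣ ψ (cst m ϖ) * b → ψ (cst m ϖ) ^ N ∣ b

/-- Reduction modulo `ϖ` on coefficients. -/
abbrev red (K : Type*) [NormedField K] [IsUltrametricDist K] (m : ℕ) :
    MvPowerSeries (Fin m) (IntegerRing K) →+*
      MvPowerSeries (Fin m) (IsLocalRing.ResidueField (IntegerRing K)) :=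
  MvPowerSeries.map (IsLocalRing.residue (IntegerRing K))

theorem residue_eq_zero_iff (hϖ : IsUnif ϖ) {x : IntegerRing K} :
    IsLocalRing.residue (IntegerRing K) x = 0 ↔ ϖ ∣ x := by
  rw [IsLocalRing.residue_eq_zero_iff, hϖ.mem_maximalIdeal_iff]

theorem red_eq_zero_iff (hϖ : IsUnif ϖ) {m : ℕ} {F : Tdag (IntegerRing K) m} :
    red K m F = 0 ↔ cst m ϖ ∣ F := by
  have h := cst_pow_dvd_iff hϖ (F := F) (N := 1)
  rw [pow_one, pow_one] at h
  rw [h, MvPowerSeries.ext_iff]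
  refine forall_congr' fun v => ?_
  rw [MvPowerSeries.coeff_map, map_zero, residue_eq_zero_iff hϖ]
  have := hϖ.pow_dvd_iff (N := 1) (x := cf v F)
  rwa [pow_one, pow_one] at this

/-- A series whose coefficients of degree larger than `d` are in the maximal ideal reduces to a
polynomial of degree at most `d`. -/
theorem exists_red_eq_polynomial {m : ℕ} {F : Tdag (IntegerRing K) m} {d : ℕ}
    (h : ∀ v, d < v.degree → ‖cf v F‖ < 1) (hϖ : IsUnif ϖ) :
    ∃ p : MvPolynomial (Fin m) (IsLocalRing.ResidueField (IntegerRing K)),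
      red K m F = (p : MvPowerSeries (Fin m) (IsLocalRing.ResidueField (IntegerRing K))) ∧
      p.totalDegree ≤ d := by
  classical
  have hfin := Finsupp.finite_of_degree_le (σ := Fin m) d
  refine ⟨MvPowerSeries.truncFinset _ hfin.toFinset (red K m F), ?_,
    (MvPowerSeries.totalDegree_truncFinset _).trans (Finset.sup_le fun v hv => by simpa using hv)⟩
  ext v
  rw [MvPolynomial.coeff_coe, MvPowerSeries.coeff_truncFinset]
  split_ifs with hv
  · rfl
  · rw [MvPowerSeries.coeff_map, residue_eq_zero_iff hϖ, hϖ.dvd_iff_lt]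
    exact h v (by simpa using hv)

/-- The image of an ideal of `𝕋†_m` in `𝕋†_m / ϖ`, which is a polynomial ring. -/
def redIdeal {m : ℕ} (I : Ideal (Tdag (IntegerRing K) m)) :
    Ideal (MvPolynomial (Fin m) (IsLocalRing.ResidueField (IntegerRing K))) where
  carrier := {p | ∃ F ∈ I, red K m F =
    (p : MvPowerSeries (Fin m) (IsLocalRing.ResidueField (IntegerRing K)))}
  zero_mem' := ⟨0, I.zero_mem, by simp⟩
  add_mem' := by
    rintro p q ⟨F, hF, hp⟩ ⟨G, hG, hq⟩
    exact ⟨F + G, I.add_mem hF hG, by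
      rw [AddMemClass.coe_add, map_add, hp, hq, MvPolynomial.coe_add]⟩
  smul_mem' := by
    rintro q p ⟨F, hF, hp⟩
    obtain ⟨Q, rfl⟩ := MvPolynomial.map_surjective _ IsLocalRing.residue_surjective q
    have hQ : (Q : MvPowerSeries (Fin m) (IntegerRing K)) ∈ Tdag (IntegerRing K) m :=
      mem_Tdag_of_degree_le (d := Q.totalDegree) fun v hv => by
        rw [MvPolynomial.coeff_coe]
        exact MvPolynomial.coeff_eq_zero_of_totalDegree_lt hv
    refine ⟨⟨Q, hQ⟩ * F, I.mul_mem_left _ hF, ?_⟩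
    rw [MulMemClass.coe_mul, map_mul, hp, smul_eq_mul, MvPolynomial.coe_mul]
    congr 1

/-- `𝕋†_m / ϖ` is noetherian: ascending chains of ideals containing `ϖ` become stationary. -/
theorem exists_stabilizes (hϖ : IsUnif ϖ) {m : ℕ} (I : ℕ →o Ideal (Tdag (IntegerRing K) m))
    (hI : cst m ϖ ∈ I 0) : ∃ e, ∀ N, e ≤ N → I N ≤ I e := by
  let J : ℕ →o Ideal (MvPolynomial (Fin m) (IsLocalRing.ResidueField (IntegerRing K))) :=
    ⟨fun N => redIdeal (I N), fun N N' h p ⟨F, hF, hp⟩ => ⟨F, I.mono h hF, hp⟩⟩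
  obtain ⟨e, he⟩ := monotone_stabilizes_iff_noetherian.2 inferInstance J
  refine ⟨e, fun N hN F hF => ?_⟩
  obtain ⟨d, hd⟩ : ∃ d : ℕ, ∀ v, d < v.degree → ‖cf v F‖ < 1 := by
    obtain ⟨ρ, C, hρ, -, hb⟩ := IsOverconvergent.exists_bd F.2
    obtain ⟨d, hd⟩ := pow_unbounded_of_one_lt C hρ
    refine ⟨d, fun v hv => ?_⟩
    by_contra hc
    have h1 : 1 * ρ ^ v.degree ≤ ‖cf v F‖ * ρ ^ v.degree := by
      gcongr
      exact not_lt.1 hc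
    have h2 : ρ ^ d ≤ ρ ^ v.degree := pow_le_pow_right₀ hρ.le hv.le
    have h3 := hb v
    change ‖cf v F‖ * ρ ^ v.degree ≤ C at h3
    linarith
  obtain ⟨p, hp, -⟩ := exists_red_eq_polynomial hd hϖ
  have hpJ : p ∈ J e := by
    rw [he N hN]
    exact ⟨F, hF, hp⟩
  obtain ⟨G, hG, hGp⟩ := hpJ
  have h1 : red K m (F - G : Tdag (IntegerRing K) m) = 0 := by
    rw [AddSubgroupClass.coe_sub, map_sub, hp, hGp, sub_self]
  rw [← sub_add_cancel F G]
  exact (I e).add_mem ((I e).mem_of_dvd ((red_eq_zero_iff hϖ).1 h1) (I.mono (Nat.zero_le e) hI)) hG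

/-- Division modulo `ϖ` by a finite subset of `ker ψ`, with control of degrees. -/
theorem exists_division_step (hϖ : IsUnif ϖ) {m : ℕ} {B : Type*} [CommRing B]
    (ψ : Tdag (IntegerRing K) m →+* B) (hψ : Function.Surjective ψ) :
    ∃ (ι : Type) (_ : Fintype ι) (f : ι → Tdag (IntegerRing K) m), (∀ i, ψ (f i) = 0) ∧
      ∀ (F : Tdag (IntegerRing K) m) (d : ℕ), ψ (cst m ϖ) ∣ ψ F →
        (∀ v, d < v.degree → ‖cf v F‖ < 1) →
        ∃ h : ι → Tdag (IntegerRing K) m, (∀ i v, d < v.degree → cf v (h i) = 0) ∧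
          cst m ϖ ∣ F - ∑ i, f i * h i := by
  classical
  let k := IsLocalRing.ResidueField (IntegerRing K)
  have hres : Function.Surjective (IsLocalRing.residue (IntegerRing K)) :=
    IsLocalRing.residue_surjective
  let 𝔞 := redIdeal (Ideal.comap ψ (Ideal.span {ψ (cst m ϖ)}))
  obtain ⟨ι, _, b, hb𝔞, hb⟩ := exists_degree_controlled_basis 𝔞
  choose F₀ hF₀ hF₀b using hb𝔞
  choose c hc using fun i => Ideal.mem_span_singleton.1 (hF₀ i)
  choose G hG using fun i => hψ (c i)
  refine ⟨ι, inferInstance, fun i => F₀ i - cst m ϖ * G i, fun i => ?_, fun F d hF hd => ?_⟩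
  · rw [map_sub, map_mul, hc, hG, sub_self]
  have hcst : red K m (cst m ϖ : Tdag (IntegerRing K) m) = 0 := (red_eq_zero_iff hϖ).2 dvd_rfl
  obtain ⟨p, hpF, hpd⟩ := exists_red_eq_polynomial hd hϖ
  obtain ⟨h, hph, hhd⟩ := hb p ⟨F, Ideal.mem_span_singleton.2 hF, hpF⟩
  obtain ⟨lift, hlift, hlift0⟩ : ∃ l : k → IntegerRing K,
      (∀ x, IsLocalRing.residue (IntegerRing K) (l x) = x) ∧ l 0 = 0 := by
    refine ⟨fun x => if x = 0 then 0 else Function.surjInv hres x, fun x => ?_, by simp⟩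
    dsimp only
    split_ifs with hx
    · rw [hx, map_zero]
    · exact Function.surjInv_eq hres x
  let H : ι → MvPowerSeries (Fin m) (IntegerRing K) := fun i v => lift ((h i).coeff v)
  have hH : ∀ i v, d < v.degree → MvPowerSeries.coeff v (H i) = 0 := fun i v hv => by
    change lift _ = 0
    rw [MvPolynomial.coeff_eq_zero_of_totalDegree_lt, hlift0]
    have := hhd i
    exact lt_of_le_of_lt (this.trans hpd) hv
  refine ⟨fun i => ⟨H i, mem_Tdag_of_degree_le (hH i)⟩, hH, (red_eq_zero_iff hϖ).1 ?_⟩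
  have hHh : ∀ i, red K m (H i) = (h i : MvPowerSeries (Fin m) k) := fun i => by
    ext v
    rw [MvPowerSeries.coeff_map, MvPolynomial.coeff_coe]
    exact hlift _
  have hsum : (p : MvPowerSeries (Fin m) k) = ∑ i, (b i : MvPowerSeries (Fin m) k) * h i := by
    rw [hph, ← MvPolynomial.coeToMvPowerSeries.ringHom_apply, map_sum]
    simp
  simp only [AddSubgroupClass.coe_sub, AddSubmonoidClass.coe_finsetSum, MulMemClass.coe_mul,
    map_sub, map_sum, map_mul, hcst, hHh, hF₀b, zero_mul, sub_zero, hpF]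
  rw [hsum, sub_self]

end Division

section Division

variable {K : Type*} [NormedField K] [IsUltrametricDist K] {ϖ : IntegerRing K}

theorem exists_common_bd {m : ℕ} {ι : Type*} [Finite ι] (f : ι → Tdag (IntegerRing K) m) {D : ℝ}
    (hD : 1 < D) :
    ∃ ρ : ℝ, 1 < ρ ∧ ∀ i, Bd ρ D (f i : MvPowerSeries (Fin m) (IntegerRing K)) := by
  cases nonempty_fintype ι
  choose r hr hb using fun i => IsOverconvergent.exists_bd_lt norm_le_one (f i).2 hD
  obtain ⟨ρ, hρ, hle⟩ : ∃ ρ : ℝ, 1 < ρ ∧ ∀ i, ρ ≤ r i := by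
    rcases isEmpty_or_nonempty ι with h | h
    · exact ⟨2, one_lt_two, fun i => h.elim i⟩
    · obtain ⟨j, hj⟩ := Finite.exists_min r
      exact ⟨r j, hr j, hj⟩
  exact ⟨ρ, hρ, fun i => (hb i).mono (by linarith) (hle i) le_rfl⟩

/-- Division modulo `ϖ` by a finite subset of `ker ψ`, with control of Gauss norms: if the divisors
have norm at most `D`, the quotients are no larger than the dividend, and the remainder divided by
`ϖ` is larger by at most the factor `D / |ϖ|`. -/
theorem exists_division_step_bd (hϖ : IsUnif ϖ) {m : ℕ} {B : Type*} [CommRing B]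
    (ψ : Tdag (IntegerRing K) m →+* B) (hψ : Function.Surjective ψ) :
    ∃ (ι : Type) (_ : Fintype ι) (f : ι → Tdag (IntegerRing K) m), (∀ i, ψ (f i) = 0) ∧
      ∀ (F : Tdag (IntegerRing K) m) (ρ D M : ℝ), 1 < ρ → 1 ≤ D → 1 ≤ M →
        (∀ i, Bd ρ D (f i : MvPowerSeries (Fin m) (IntegerRing K))) →
        Bd ρ M (F : MvPowerSeries (Fin m) (IntegerRing K)) → ψ (cst m ϖ) ∣ ψ F →
        ∃ (h : ι → Tdag (IntegerRing K) m) (G : Tdag (IntegerRing K) m),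
          F = ∑ i, f i * h i + cst m ϖ * G ∧
          (∀ i, Bd ρ M (h i : MvPowerSeries (Fin m) (IntegerRing K))) ∧
          Bd ρ (M * (D / ‖ϖ‖)) (G : MvPowerSeries (Fin m) (IntegerRing K)) := by
  obtain ⟨ι, _, f, hf, hstep⟩ := exists_division_step hϖ ψ hψ
  refine ⟨ι, inferInstance, f, hf, fun F ρ D M hρ hD hM hfD hF hw => ?_⟩
  have h0 : 0 < ρ := by linarith
  -- coefficients of degree larger than `log M / log ρ` have absolute value less than `1`
  obtain ⟨d, hd1, hd2⟩ := exists_nat_pow_near hM hρ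
  obtain ⟨h, hhd, hh⟩ := hstep F d hw fun v hv => by
    have h1 := hF v
    have h2 : ρ ^ (d + 1) ≤ ρ ^ v.degree := pow_le_pow_right₀ hρ.le hv
    by_contra hc
    have h3 : 1 ≤ ‖cf v F‖ := not_lt.1 hc
    have h4 : 1 * ρ ^ v.degree ≤ ‖cf v F‖ * ρ ^ v.degree := by gcongr
    change ‖cf v F‖ * ρ ^ v.degree ≤ M at h1
    linarith
  have hhM : ∀ i, Bd ρ M (h i : MvPowerSeries (Fin m) (IntegerRing K)) := fun i =>
    (bd_of_degree_le hρ.le (hhd i)).mono h0.le le_rfl hd1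
  rw [← pow_one (cst m ϖ), cst_pow_dvd_iff hϖ] at hh
  obtain ⟨G, hG, hGb⟩ := exists_eq_cst_pow_mul hϖ hh
  refine ⟨h, G, by rw [pow_one] at hG; rw [← hG]; ring, hhM, ?_⟩
  have hDM : 0 ≤ D * M := by positivity
  have := hGb ρ (D * M) (by
    rw [AddSubgroupClass.coe_sub, AddSubmonoidClass.coe_finsetSum]
    refine Bd.sub h0.le (hF.mono h0.le le_rfl (by nlinarith)) (Bd.sum h0.le hDM _ _ fun i _ => ?_)
    rw [MulMemClass.coe_mul]
    exact (hfD i).mul h0 (by linarith) (by linarith) (hhM i))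
  refine this.mono h0.le le_rfl (le_of_eq ?_)
  rw [pow_one]
  ring

namespace FlatPresentation

variable {m : ℕ} {B : Type*} [CommRing B] {ψ : Tdag (IntegerRing K) m →+* B}

/-- `B` is `ϖ`-adically separated. If `ψ F` is divisible by all powers of `ϖ`, then `F` is a
combination of finitely many elements of `ker ψ`: dividing again and again by `ϖ` modulo `ker ψ`,
the quotients add up to overconvergent series. -/
theorem eq_zero_of_forall_pow_dvd [CompleteSpace K] (hϖ : IsUnif ϖ) (hg : FlatPresentation ϖ ψ)
    {b : B} (hb : ∀ N, ψ (cst m ϖ) ^ N ∣ b) : b = 0 := by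
  obtain ⟨F₀, rfl⟩ := hg.surj b
  obtain ⟨ι, _, f, hf, hstep⟩ := exists_division_step_bd hϖ ψ hg.surj
  have hD : 1 < ‖ϖ‖⁻¹ := (one_lt_inv₀ hϖ.pos).2 hϖ.lt_one
  obtain ⟨ρ₁, hρ₁, hf₁⟩ := exists_common_bd f hD
  obtain ⟨ρ₂, C, hρ₂, hC, hF₂⟩ := IsOverconvergent.exists_bd F₀.2
  set ρ := min ρ₁ ρ₂
  have hρ : 1 < ρ := lt_min hρ₁ hρ₂
  have h0 : 0 ≤ ρ := by linarith
  set M := max C 1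
  have hM : 1 ≤ M := le_max_right _ _
  set q := ‖ϖ‖⁻¹ / ‖ϖ‖
  have hq : 1 ≤ q := by
    rw [one_le_div hϖ.pos]
    exact hϖ.lt_one.le.trans hD.le
  have hfρ : ∀ i, Bd ρ ‖ϖ‖⁻¹ (f i : MvPowerSeries (Fin m) (IntegerRing K)) := fun i =>
    (hf₁ i).mono h0 (min_le_left _ _) le_rfl
  let P : ℕ → Tdag (IntegerRing K) m → Prop := fun k F =>
    Bd ρ (M * q ^ k) (F : MvPowerSeries (Fin m) (IntegerRing K)) ∧ ∀ N, ψ (cst m ϖ) ^ N ∣ ψ F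
  have hex : ∀ k F, P k F → ∃ (h : ι → Tdag (IntegerRing K) m) (G : Tdag (IntegerRing K) m),
      P (k + 1) G ∧ F = ∑ i, f i * h i + cst m ϖ * G ∧
      ∀ i, Bd ρ (M * q ^ k) (h i : MvPowerSeries (Fin m) (IntegerRing K)) := by
    rintro k F ⟨hFb, hF⟩
    obtain ⟨h, G, hFG, hh, hG⟩ := hstep F ρ ‖ϖ‖⁻¹ (M * q ^ k) hρ hD.le
      (one_le_mul_of_one_le_of_one_le hM (one_le_pow₀ hq)) hfρ hFb (by simpa using hF 1)
    have hψ : ψ F = ψ (cst m ϖ) * ψ G := by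
      rw [hFG, map_add, map_sum, map_mul,
        Finset.sum_eq_zero fun i _ => by rw [map_mul, hf, zero_mul], zero_add]
    refine ⟨h, G, ⟨by rw [pow_succ, ← mul_assoc]; exact hG, fun N => hg.tors N _ ?_⟩, hFG, hh⟩
    rw [← hψ]
    exact hF _
  choose h G hP hFG hh using hex
  let s : ∀ k, {F // P k F} := fun k => Nat.rec (motive := fun k => {F // P k F})
    ⟨F₀, by simpa using hF₂.mono h0 (min_le_right _ _) (le_max_left C 1), hb⟩
    (fun k F => ⟨G k F.1 F.2, hP k F.1 F.2⟩) k
  obtain ⟨u, a, hu0, hs, ha⟩ : ∃ (u : ℕ → Tdag (IntegerRing K) m)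
      (a : ℕ → ι → Tdag (IntegerRing K) m), u 0 = F₀ ∧
      (∀ k, u k = ∑ i, f i * a k i + cst m ϖ * u (k + 1)) ∧
      ∀ k i, Bd ρ (M * q ^ k) (a k i : MvPowerSeries (Fin m) (IntegerRing K)) :=
    ⟨fun k => (s k).1, fun k => h k (s k).1 (s k).2, rfl, fun k => hFG k (s k).1 (s k).2,
      fun k => hh k (s k).1 (s k).2⟩
  have hqϖ : q * ‖ϖ‖ ^ 2 ≤ 1 := by
    have := hϖ.pos.ne'
    simp only [q]
    field_simp
    rfl
  choose H hH using fun i => exists_tsum hϖ (fun k => a k i) hρ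
    (by linarith) (by linarith) hqϖ fun k => ha k i
  have hpart : ∀ N, F₀ - ∑ i, f i * ∑ k ∈ Finset.range N, cst m ϖ ^ k * a k i =
      cst m ϖ ^ N * u N := by
    intro N
    induction N with
    | zero =>
      simp only [Finset.range_zero, Finset.sum_empty, mul_zero, Finset.sum_const_zero, sub_zero,
        pow_zero, one_mul, hu0]
    | succ N ih =>
      have h1 : ∑ i, f i * (cst m ϖ ^ N * a N i) = cst m ϖ ^ N * ∑ i, f i * a N i := by
        rw [Finset.mul_sum]
        exact Finset.sum_congr rfl fun i _ => by ring
      simp only [Finset.sum_range_succ, mul_add, Finset.sum_add_distrib]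
      linear_combination ih - h1 + cst m ϖ ^ N * hs N
  have hF : F₀ = ∑ i, f i * H i := by
    refine eq_of_forall_cst_pow_dvd hϖ fun N => ?_
    have h1 : cst m ϖ ^ N ∣ ∑ i, f i * (H i -
        ∑ k ∈ Finset.range N, cst m ϖ ^ k * a k i) :=
      Finset.dvd_sum fun i _ => (hH i N).mul_left _
    have h2 := (Dvd.intro _ (hpart N).symm).sub h1
    simp only [mul_sub, Finset.sum_sub_distrib] at h2
    simpa using h2
  rw [hF, map_sum]
  exact Finset.sum_eq_zero fun i _ => by rw [map_mul, hf, zero_mul]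

/-- Division by `ϖ^N` modulo `ker ψ`, with control of Gauss norms. -/
theorem exists_division (hϖ : IsUnif ϖ) (hg : FlatPresentation ϖ ψ) {D : ℝ} (hD : 1 < D) :
    ∃ ρ₀ : ℝ, 1 < ρ₀ ∧ ∀ (N : ℕ) (F : Tdag (IntegerRing K) m) (ρ M : ℝ), 1 < ρ → ρ ≤ ρ₀ → 1 ≤ M →
      Bd ρ M (F : MvPowerSeries (Fin m) (IntegerRing K)) → ψ (cst m ϖ) ^ N ∣ ψ F →
      ∃ t : Tdag (IntegerRing K) m, ψ F = ψ (cst m ϖ) ^ N * ψ t ∧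
        Bd ρ (M * (D / ‖ϖ‖) ^ N) (t : MvPowerSeries (Fin m) (IntegerRing K)) := by
  obtain ⟨ι, _, f, hf, hstep⟩ := exists_division_step_bd hϖ ψ hg.surj
  obtain ⟨ρ₀, hρ₀, hf₀⟩ := exists_common_bd f hD
  refine ⟨ρ₀, hρ₀, fun N => ?_⟩
  induction N with
  | zero => exact fun F ρ M _ _ _ hF _ => ⟨F, by simp, by simpa using hF⟩
  | succ N ih =>
    intro F ρ M hρ hρρ hM hF hN
    obtain ⟨h, G, hFG, -, hG⟩ := hstep F ρ D M hρ hD.le hM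
      (fun i => (hf₀ i).mono (by linarith) hρρ le_rfl) hF ((dvd_pow_self _ (by omega)).trans hN)
    have hψ : ψ F = ψ (cst m ϖ) * ψ G := by
      rw [hFG, map_add, map_sum, map_mul,
        Finset.sum_eq_zero fun i _ => by rw [map_mul, hf, zero_mul], zero_add]
    have hq : 1 ≤ D / ‖ϖ‖ := by
      rw [one_le_div hϖ.pos]
      exact hϖ.lt_one.le.trans hD.le
    obtain ⟨t, ht, htb⟩ := ih G ρ (M * (D / ‖ϖ‖)) hρ hρρ (one_le_mul_of_one_le_of_one_le hM hq) hG
      (hg.tors N _ (hψ ▸ hN))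
    refine ⟨t, by rw [hψ, ht]; ring, htb.mono (by linarith) le_rfl (le_of_eq (by ring))⟩

/-- A sequence in `B` that is Cauchy for the `ϖ`-adic topology converges in `B`, provided that it
has representatives whose Gauss norms grow slowly. -/
theorem exists_limit [CompleteSpace K] (hϖ : IsUnif ϖ) (hg : FlatPresentation ϖ ψ)
    (S : ℕ → Tdag (IntegerRing K) m) {ρ C E : ℝ} (hρ : 1 < ρ) (hE : 1 ≤ E) (hEϖ : E * ‖ϖ‖ < 1)
    (hS : ∀ N, Bd ρ (C * E ^ N) (S N : MvPowerSeries (Fin m) (IntegerRing K)))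
    (hcauchy : ∀ N, ψ (cst m ϖ) ^ N ∣ ψ (S (N + 1)) - ψ (S N)) :
    ∃ b : B, ∀ N, ψ (cst m ϖ) ^ N ∣ b - ψ (S N) := by
  have hE0 : 0 < E * ‖ϖ‖ := mul_pos (by linarith) hϖ.pos
  obtain ⟨ρ₀, hρ₀, hdiv⟩ := hg.exists_division hϖ ((one_lt_inv₀ hE0).2 hEϖ)
  set ρ' := min ρ₀ ρ
  have hρ' : 1 < ρ' := lt_min hρ₀ hρ
  have h0 : 0 ≤ ρ' := by linarith
  set C' := max C 1
  have hC' : 1 ≤ C' := le_max_right _ _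
  have hS' : ∀ N k, N ≤ k + 1 → Bd ρ' (C' * E * E ^ k)
      (S N : MvPowerSeries (Fin m) (IntegerRing K)) := fun N k hN => by
    refine (hS N).mono h0 (min_le_right _ _) ?_
    rw [mul_assoc, ← pow_succ']
    exact mul_le_mul (le_max_left _ _) (pow_le_pow_right₀ hE hN) (by positivity) (by linarith)
  choose t ht htb using fun N => hdiv N (S (N + 1) - S N) ρ' (C' * E * E ^ N) hρ' (min_le_left _ _)
    (one_le_mul_of_one_le_of_one_le (one_le_mul_of_one_le_of_one_le hC' hE) (one_le_pow₀ hE))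
    ((hS' (N + 1) N le_rfl).sub h0 (hS' N N (by omega))) (by rw [map_sub]; exact hcauchy N)
  obtain ⟨T, hT⟩ := exists_tsum hϖ t (q := E * ((E * ‖ϖ‖)⁻¹ / ‖ϖ‖)) (C := C' * E) hρ'
    (by positivity) (by positivity) (by
      have := hϖ.pos.ne'
      field_simp
      rfl) fun k => (htb k).mono h0 le_rfl (le_of_eq (by ring))
  refine ⟨ψ (S 0 + T), fun N => ?_⟩
  have h1 : ψ (∑ k ∈ Finset.range N, cst m ϖ ^ k * t k) = ψ (S N) - ψ (S 0) := by
    rw [map_sum, ← Finset.sum_range_sub (fun k => ψ (S k))]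
    exact Finset.sum_congr rfl fun k _ => by rw [map_mul, map_pow, ← ht, map_sub]
  have h2 := map_dvd ψ (hT N)
  rw [map_sub, h1, map_pow] at h2
  convert h2 using 1
  rw [map_add]
  ring

/-- `ϖ` lies in the Jacobson radical of `B`: the geometric series `∑ (-ϖ G)^k` is overconvergent. -/
theorem isUnit_one_add [CompleteSpace K] (hϖ : IsUnif ϖ) (hψ : Function.Surjective ψ) (b : B) :
    IsUnit (1 + ψ (cst m ϖ) * b) := by
  obtain ⟨G, rfl⟩ := hψ b
  have hD : 1 < ‖ϖ‖⁻¹ := (one_lt_inv₀ hϖ.pos).2 hϖ.lt_one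
  obtain ⟨ρ, hρ, hG⟩ := IsOverconvergent.exists_bd_lt norm_le_one (-G).2 hD
  obtain ⟨H, hH⟩ := exists_tsum hϖ (fun k => (-G) ^ k) hρ zero_le_one (by positivity)
    (q := ‖ϖ‖⁻¹) (by
      have := hϖ.pos.ne'
      field_simp
      exact hϖ.lt_one.le) fun k => by
        rw [one_mul, SubmonoidClass.coe_pow]
        exact hG.pow (by linarith) (by positivity) k
  have : (1 + cst m ϖ * G) * H = 1 := by
    refine eq_of_forall_cst_pow_dvd hϖ fun N => ?_
    have h1 := (hH N).mul_left (1 + cst m ϖ * G)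
    have h2 : (1 + cst m ϖ * G) * ∑ k ∈ Finset.range N, cst m ϖ ^ k * (-G) ^ k =
        1 - cst m ϖ ^ N * (-G) ^ N := by
      have := mul_neg_geom_sum (cst m ϖ * -G) N
      simp only [mul_pow] at this
      rw [← this]
      ring
    rw [mul_sub, h2] at h1
    convert h1.sub (dvd_mul_right (cst m ϖ ^ N) ((-G) ^ N)) using 1
    ring
  rw [← map_one ψ, ← map_mul, ← map_add]
  exact (IsUnit.of_mul_eq_one _ this).map ψ

end FlatPresentation

end Division

/-! ### Expansion in powers of the adjoined variable -/

section Expansion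

variable {K : Type*} [NormedField K] [IsUltrametricDist K]

theorem Bd.xiCoeff {n : ℕ} {ρ M : ℝ} (hρ : 0 < ρ) {F : MvPowerSeries (Fin (n + 1)) (IntegerRing K)}
    (h : Bd ρ M F) (j : ℕ) :
    Bd ρ (M / ρ ^ j) (PowerSeries.coeff j (MvPowerSeries.finSuccEquiv (IntegerRing K) n F)) := by
  intro v
  have := h (v.cons j)
  rw [degree_cons, pow_add] at this
  rw [MvPowerSeries.coeff_coeff_finSuccEquiv, le_div_iff₀ (by positivity)]
  linarith

/-- The expansion `F = ∑ F_j ξ^j` of a series in `𝕋†_{n+1}`, with `F_j ∈ 𝕋†_n`. -/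
def xiSeries (K : Type*) [NormedField K] [IsUltrametricDist K] (n : ℕ) :
    Tdag (IntegerRing K) (n + 1) →+* PowerSeries (Tdag (IntegerRing K) n) where
  toFun F := PowerSeries.mk fun j =>
    ⟨PowerSeries.coeff j (MvPowerSeries.finSuccEquiv (IntegerRing K) n F), by
      obtain ⟨ρ, C, hρ, -, h⟩ := IsOverconvergent.exists_bd F.2
      exact (h.xiCoeff (by linarith) j).isOverconvergent hρ⟩
  map_one' := by
    ext j : 1
    refine Subtype.ext ?_
    rw [PowerSeries.coeff_mk, PowerSeries.coeff_one]
    simp only [OneMemClass.coe_one, map_one, PowerSeries.coeff_one]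
    split_ifs <;> rfl
  map_zero' := by
    ext j : 1
    refine Subtype.ext ?_
    simp
  map_add' F G := by
    ext j : 1
    refine Subtype.ext ?_
    simp
  map_mul' F G := by
    ext j : 1
    refine Subtype.ext ?_
    rw [PowerSeries.coeff_mk, PowerSeries.coeff_mul]
    simp [PowerSeries.coeff_mul, AddSubmonoidClass.coe_finsetSum]

/-- The coefficient `F_j ∈ 𝕋†_n` of `ξ^j` in `F ∈ 𝕋†_{n+1}`. -/
abbrev xiCoeff {n : ℕ} (j : ℕ) (F : Tdag (IntegerRing K) (n + 1)) : Tdag (IntegerRing K) n :=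
  PowerSeries.coeff j (xiSeries K n F)

theorem coe_xiCoeff {n : ℕ} (j : ℕ) (F : Tdag (IntegerRing K) (n + 1)) :
    (xiCoeff j F : MvPowerSeries (Fin n) (IntegerRing K)) =
      PowerSeries.coeff j (MvPowerSeries.finSuccEquiv (IntegerRing K) n F) := by
  simp [xiCoeff, xiSeries]

theorem cf_xiCoeff {n : ℕ} (j : ℕ) (F : Tdag (IntegerRing K) (n + 1)) (v : Fin n →₀ ℕ) :
    cf v (xiCoeff j F) = cf (v.cons j) F := by
  rw [cf, coe_xiCoeff, MvPowerSeries.coeff_coeff_finSuccEquiv]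

theorem xiSeries_incl {n : ℕ} (a : Tdag (IntegerRing K) n) :
    xiSeries K n (incl K n a) = PowerSeries.C a := by
  ext j : 1
  refine Subtype.ext ?_
  rw [← xiCoeff, coe_xiCoeff, incl_coe, PowerSeries.coeff_C, PowerSeries.coeff_C]
  split_ifs <;> rfl

theorem xiSeries_newVar {n : ℕ} : xiSeries K n (newVar K n) = PowerSeries.X := by
  ext j : 1
  refine Subtype.ext ?_
  rw [← xiCoeff, coe_xiCoeff, newVar_coe, PowerSeries.coeff_X, PowerSeries.coeff_X]
  split_ifs <;> rfl

theorem incl_cst {n : ℕ} (r : IntegerRing K) : incl K n (cst n r) = cst (n + 1) r := by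
  refine ext_finSucc ?_
  rw [incl_coe]
  change _ = MvPowerSeries.finSuccEquiv (IntegerRing K) n (algebraMap _ _ r)
  rw [AlgEquiv.commutes, PowerSeries.algebraMap_apply]
  rfl

variable {ϖ : IntegerRing K}

/-- Modulo `ϖ^N`, a series in `𝕋†_{n+1}` is a polynomial in `ξ`, of degree at most linear
in `N`. -/
theorem exists_pow_dvd_xiCoeff (hϖ : IsUnif ϖ) {n : ℕ} (F : Tdag (IntegerRing K) (n + 1)) :
    ∃ c₀ : ℕ, ∀ c, c₀ ≤ c → ∀ N j, c * (N + 1) ≤ j → cst n ϖ ^ N ∣ xiCoeff j F := by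
  obtain ⟨ρ, C, hρ, hC, hF⟩ := IsOverconvergent.exists_bd F.2
  have h0 : 0 < ρ := by linarith
  obtain ⟨c₁, hc₁⟩ := pow_unbounded_of_one_lt C hρ
  obtain ⟨c₂, hc₂⟩ := pow_unbounded_of_one_lt ‖ϖ‖⁻¹ hρ
  refine ⟨max c₁ c₂, fun c hc N j hj => (cst_pow_dvd_iff hϖ).2 fun v => ?_⟩
  rw [cf_xiCoeff]
  have hϖ' := hϖ.pos
  have h1 : ρ ^ (c * (N + 1)) ≤ ρ ^ (v.cons j).degree :=
    pow_le_pow_right₀ hρ.le (by rw [degree_cons]; omega)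
  have hC' : C ≤ ρ ^ c := hc₁.le.trans (pow_le_pow_right₀ hρ.le (by omega))
  have hϖ'' : ‖ϖ‖⁻¹ ≤ ρ ^ c := hc₂.le.trans (pow_le_pow_right₀ hρ.le (by omega))
  have h2 : ρ ^ (c * (N + 1)) = (ρ ^ c) ^ N * ρ ^ c := by rw [pow_mul, pow_succ]
  have h3 := hF (v.cons j)
  change ‖cf (v.cons j) F‖ * _ ≤ C at h3
  have h4 : ‖cf (v.cons j) F‖ * ((ρ ^ c) ^ N * ρ ^ c) ≤ ρ ^ c := by
    rw [← h2]
    exact (mul_le_mul_of_nonneg_left h1 (norm_nonneg _)).trans (h3.trans hC')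
  have h5 : ‖cf (v.cons j) F‖ * (ρ ^ c) ^ N ≤ 1 := by
    have : 0 < ρ ^ c := by positivity
    rw [← mul_assoc] at h4
    exact le_of_mul_le_mul_right (by linarith) this
  have h6 : ‖cf (v.cons j) F‖ * (‖ϖ‖⁻¹) ^ N ≤ 1 := by
    refine le_trans ?_ h5
    gcongr
  rw [inv_pow, ← div_eq_mul_inv, div_le_one (by positivity)] at h6
  exact h6

theorem pow_dvd_sub_sum (hϖ : IsUnif ϖ) {n : ℕ} {F : Tdag (IntegerRing K) (n + 1)} {N d : ℕ}
    (h : ∀ j, d ≤ j → cst n ϖ ^ N ∣ xiCoeff j F) :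
    cst (n + 1) ϖ ^ N ∣ F - ∑ j ∈ Finset.range d, incl K n (xiCoeff j F) * newVar K n ^ j := by
  refine (cst_pow_dvd_iff hϖ).2 fun w => ?_
  obtain ⟨j, v, rfl⟩ : ∃ j v, w = Finsupp.cons j v := ⟨w 0, w.tail, (Finsupp.cons_tail w).symm⟩
  have hcoeff : cf (v.cons j) (∑ j ∈ Finset.range d,
      incl K n (xiCoeff j F) * newVar K n ^ j) = if j < d then cf (v.cons j) F else 0 := by
    rw [← cf_xiCoeff, ← cf_xiCoeff, xiCoeff, map_sum, map_sum]
    simp only [map_mul, map_pow, xiSeries_incl, xiSeries_newVar, PowerSeries.coeff_C_mul,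
      PowerSeries.coeff_X_pow, mul_ite, mul_one, mul_zero]
    rw [Finset.sum_ite_eq]
    simp only [Finset.mem_range]
    split_ifs <;> simp [cf]
  rw [cf_sub, hcoeff]
  split_ifs with hj
  · rw [sub_self, norm_zero]
    positivity
  · rw [sub_zero, ← cf_xiCoeff]
    exact (cst_pow_dvd_iff hϖ).1 (h j (not_lt.1 hj)) v

end Expansion

/-! ### The localizations modulo powers of the uniformizer -/

section Localization

variable {K : Type*} [NormedField K] [IsUltrametricDist K] {ϖ : IntegerRing K}
variable {A : Type*} [CommRing A] [Algebra (IntegerRing K) A] (P : Presentation K A)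

/-- The presentation `𝕋†_{n+1} → A⟨f⁻¹⟩†`. -/
def Loc.rep (f : A) : Tdag (IntegerRing K) (P.n + 1) →+* Loc P f :=
  (Loc.mk P f : Adjoin P →+* Loc P f).comp (Adjoin.mk P)

/-- The uniformizer as an element of `A⟨f⁻¹⟩†`. -/
abbrev Loc.unif (f : A) (ϖ : IntegerRing K) : Loc P f :=
  algebraMap A (Loc P f) (algebraMap (IntegerRing K) A ϖ)

theorem Loc.rep_surjective (f : A) : Function.Surjective (Loc.rep P f) :=
  (Loc.mk_surjective P f).comp (Adjoin.mk_surjective P)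

theorem Loc.rep_incl (f : A) (a : Tdag (IntegerRing K) P.n) :
    Loc.rep P f (incl K P.n a) = algebraMap A (Loc P f) (P.toHom a) := by
  change Loc.mk P f (Adjoin.mk P (incl K P.n a)) = _
  rw [← Adjoin.algebraMap_toHom, AlgHom.commutes]

theorem Loc.rep_cst (f : A) (r : IntegerRing K) :
    Loc.rep P f (cst (P.n + 1) r) = Loc.unif P f r := by
  rw [← incl_cst, Loc.rep_incl, AlgHom.commutes]

theorem Loc.algebraMap_mul_rep_newVar (f : A) :
    algebraMap A (Loc P f) f * Loc.rep P f (newVar K P.n) = 1 :=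
  Loc.algebraMap_mul_xi P f

theorem Loc.isUnit_algebraMap (f : A) : IsUnit (algebraMap A (Loc P f) f) :=
  IsUnit.of_mul_eq_one _ (Loc.algebraMap_mul_xi P f)

/-- The homomorphism `𝕋†_{n+1} → A⟦ξ⟧` through which `A⟨ξ⟩†` maps to `A⟦ξ⟧`. -/
def toPowerSeries : Tdag (IntegerRing K) (P.n + 1) →+* PowerSeries A :=
  (PowerSeries.map (P.toHom : Tdag (IntegerRing K) P.n →+* A)).comp (xiSeries K P.n)

theorem coeff_toPowerSeries (j : ℕ) (F : Tdag (IntegerRing K) (P.n + 1)) :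
    PowerSeries.coeff j (toPowerSeries P F) = P.toHom (xiCoeff j F) := by
  simp [toPowerSeries]

theorem toPowerSeries_incl (a : Tdag (IntegerRing K) P.n) :
    toPowerSeries P (incl K P.n a) = PowerSeries.C (P.toHom a) := by
  simp [toPowerSeries, xiSeries_incl]

theorem toPowerSeries_newVar : toPowerSeries P (newVar K P.n) = PowerSeries.X := by
  simp [toPowerSeries, xiSeries_newVar]

/-- An element of the kernel of `𝕋†_{n+1} → A⟨f⁻¹⟩†` becomes a multiple of `f ξ - 1` in
`A⟦ξ⟧`, with quotient coming from `𝕋†_{n+1}`. -/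
theorem Loc.exists_of_rep_eq_zero {f : A} {E : Tdag (IntegerRing K) (P.n + 1)}
    (h : Loc.rep P f E = 0) : ∃ H : Tdag (IntegerRing K) (P.n + 1),
      toPowerSeries P E = (PowerSeries.C f * PowerSeries.X - 1) * toPowerSeries P H := by
  have hI : (RingHom.ker P.toHom).map (incl K P.n) ≤ RingHom.ker (toPowerSeries P) := by
    rw [Ideal.map_le_iff_le_comap]
    intro x hx
    rw [Ideal.mem_comap, RingHom.mem_ker, toPowerSeries_incl, RingHom.mem_ker.1 hx, map_zero]
  obtain ⟨φ, rfl⟩ := P.surjective f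
  have h1 : Adjoin.mk P E ∈ Ideal.span {algebraMap A (Adjoin P) (P.toHom φ) * Adjoin.xi P - 1} :=
    Ideal.Quotient.eq_zero_iff_mem.1 h
  obtain ⟨y, hy⟩ := Ideal.mem_span_singleton.1 h1
  obtain ⟨H, rfl⟩ := Adjoin.mk_surjective P y
  rw [Adjoin.algebraMap_toHom, Adjoin.xi, ← map_mul, ← map_one (Adjoin.mk P), ← map_sub, ← map_mul,
    ← sub_eq_zero, ← map_sub] at hy
  have h2 := hI (Ideal.Quotient.eq_zero_iff_mem.1 hy)
  rw [RingHom.mem_ker, map_sub, sub_eq_zero] at h2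
  refine ⟨H, h2.trans ?_⟩
  rw [map_mul, map_sub, map_mul, map_one, toPowerSeries_incl, toPowerSeries_newVar]

/-- An element of `A` that vanishes in `A⟨f⁻¹⟩† / ϖ^N` vanishes in `(A / ϖ^N)_f`: compare the
coefficients of the powers of `ξ`, nearly all of which vanish modulo `ϖ^N`. -/
theorem Loc.exists_pow_mul_dvd (hϖ : IsUnif ϖ) {f a : A} {N : ℕ}
    (h : Loc.unif P f ϖ ^ N ∣ algebraMap A (Loc P f) a) :
    ∃ m, algebraMap (IntegerRing K) A ϖ ^ N ∣ f ^ m * a := by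
  set w := algebraMap (IntegerRing K) A ϖ
  have hcst : P.toHom (cst P.n ϖ) = w := AlgHom.commutes _ _
  obtain ⟨y, hy⟩ := h
  obtain ⟨G, rfl⟩ := Loc.rep_surjective P f y
  obtain ⟨α, rfl⟩ := P.surjective a
  have h0 : Loc.rep P f (cst _ ϖ ^ N * G - incl K P.n α) = 0 := by
    rw [map_sub, map_mul, map_pow, Loc.rep_incl, Loc.rep_cst, hy, sub_self]
  obtain ⟨H, hH⟩ := Loc.exists_of_rep_eq_zero P h0
  rw [map_sub, map_mul, map_pow, ← incl_cst, toPowerSeries_incl, toPowerSeries_incl, hcst,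
    ← map_pow, sub_mul, one_mul, mul_assoc] at hH
  set h := fun j => P.toHom (xiCoeff j H) with hh
  have hcong : ∀ j, w ^ N ∣ h j - f ^ j * P.toHom α := by
    intro j
    have hj := congrArg (PowerSeries.coeff j) hH
    rw [map_sub, map_sub, PowerSeries.coeff_C_mul, PowerSeries.coeff_C_mul, coeff_toPowerSeries,
      coeff_toPowerSeries] at hj
    induction j with
    | zero =>
      rw [PowerSeries.coeff_zero_C, PowerSeries.coeff_zero_X_mul] at hj
      exact ⟨-P.toHom (xiCoeff 0 G), by simp only [hh, pow_zero]; linear_combination hj⟩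
    | succ j ih =>
      have hj' := congrArg (PowerSeries.coeff j) hH
      rw [map_sub, map_sub, PowerSeries.coeff_C_mul, PowerSeries.coeff_C_mul, coeff_toPowerSeries,
        coeff_toPowerSeries] at hj'
      obtain ⟨z, hz⟩ := ih hj'
      rw [PowerSeries.coeff_succ_C, PowerSeries.coeff_succ_X_mul, coeff_toPowerSeries] at hj
      exact ⟨f * z - P.toHom (xiCoeff (j + 1) G), by
        simp only [hh] at hz ⊢
        linear_combination f * hz + hj⟩
  obtain ⟨c, hc⟩ := exists_pow_dvd_xiCoeff hϖ H
  have hlarge : w ^ N ∣ h (c * (N + 1)) := by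
    have := map_dvd P.toHom (hc c le_rfl N _ le_rfl)
    rwa [map_pow, hcst] at this
  exact ⟨c * (N + 1), (dvd_sub_right hlarge).1 (hcong _)⟩

/-- The numerator `∑_{j < d} F_j φ^{d-j}` of the truncation `∑_{j < d} F_j φ^{-j}` over the
denominator `φ^d`. -/
def numerator {n : ℕ} (φ : Tdag (IntegerRing K) n) (d : ℕ) (F : Tdag (IntegerRing K) (n + 1)) :
    Tdag (IntegerRing K) n :=
  ∑ j ∈ Finset.range d, xiCoeff j F * φ ^ (d - j)

theorem bd_numerator {n : ℕ} {ρ C D : ℝ} (hρ : 1 ≤ ρ) (hC : 0 ≤ C) (hD : 1 ≤ D)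
    {φ : Tdag (IntegerRing K) n} {F : Tdag (IntegerRing K) (n + 1)}
    (hφ : Bd ρ D (φ : MvPowerSeries (Fin n) (IntegerRing K)))
    (hF : Bd ρ C (F : MvPowerSeries (Fin (n + 1)) (IntegerRing K))) (d : ℕ) :
    Bd ρ (C * D ^ d) (numerator φ d F : MvPowerSeries (Fin n) (IntegerRing K)) := by
  have h0 : 0 < ρ := by linarith
  have hD0 : 0 ≤ D := by linarith
  rw [numerator, AddSubmonoidClass.coe_finsetSum]
  refine Bd.sum h0.le (by positivity) _ _ fun j _ => ?_
  rw [MulMemClass.coe_mul, SubmonoidClass.coe_pow, coe_xiCoeff]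
  exact Bd.mul h0 hC (by positivity)
    ((hF.xiCoeff h0 j).mono h0.le le_rfl (div_le_self hC (one_le_pow₀ hρ)))
    ((hφ.pow h0 hD0 _).mono h0.le le_rfl (pow_le_pow_right₀ hD (Nat.sub_le _ _)))

theorem Loc.dvd_pow_mul_sub_numerator (hϖ : IsUnif ϖ) (φ : Tdag (IntegerRing K) P.n) {N d : ℕ}
    {F : Tdag (IntegerRing K) (P.n + 1)} (h : ∀ j, d ≤ j → cst P.n ϖ ^ N ∣ xiCoeff j F) :
    Loc.unif P (P.toHom φ) ϖ ^ N ∣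
      algebraMap A (Loc P (P.toHom φ)) (P.toHom φ) ^ d * Loc.rep P (P.toHom φ) F -
        algebraMap A (Loc P (P.toHom φ)) (P.toHom (numerator φ d F)) := by
  set g := P.toHom φ with hg
  have h1 := (map_dvd (Loc.rep P g) (pow_dvd_sub_sum hϖ h)).mul_left
    (algebraMap A (Loc P g) g ^ d)
  rw [map_pow, Loc.rep_cst, map_sub, mul_sub] at h1
  convert h1 using 2
  rw [numerator, map_sum, map_sum, map_sum, Finset.mul_sum]
  refine Finset.sum_congr rfl fun j hj => ?_
  have hj' : d = (d - j) + j := by have := Finset.mem_range.1 hj; omega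
  rw [map_mul, map_mul, map_pow, map_pow, map_mul, map_pow, Loc.rep_incl, ← hg]
  nth_rewrite 2 [hj']
  rw [pow_add]
  have h2 : algebraMap A (Loc P g) g ^ j * Loc.rep P g (newVar K P.n) ^ j = 1 := by
    rw [← mul_pow, Loc.algebraMap_mul_rep_newVar, one_pow]
  linear_combination -(algebraMap A (Loc P g) (P.toHom (xiCoeff j F)) *
    algebraMap A (Loc P g) g ^ (d - j)) * h2

/-- Every element of `A⟨f⁻¹⟩†` is modulo `ϖ^N` a quotient `a / f^m` with `a ∈ A`. -/
theorem Loc.exists_pow_mul_sub_dvd (hϖ : IsUnif ϖ) {f : A} (b : Loc P f) (N : ℕ) :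
    ∃ (m : ℕ) (a : A), Loc.unif P f ϖ ^ N ∣
      algebraMap A (Loc P f) f ^ m * b - algebraMap A (Loc P f) a := by
  obtain ⟨φ, rfl⟩ := P.surjective f
  obtain ⟨F, rfl⟩ := Loc.rep_surjective P _ b
  obtain ⟨c, hc⟩ := exists_pow_dvd_xiCoeff hϖ F
  exact ⟨_, _, Loc.dvd_pow_mul_sub_numerator P hϖ φ (hc c le_rfl N)⟩

variable (ϖ) in
/-- The condition that `ϖ` is not a zero divisor in `A`. -/
def TorsionFree (A : Type*) [CommRing A] [Algebra (IntegerRing K) A] : Prop :=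
  ∀ a : A, algebraMap (IntegerRing K) A ϖ * a = 0 → a = 0

theorem TorsionFree.dvd (hA : TorsionFree ϖ A) {N : ℕ} {a : A}
    (h : algebraMap (IntegerRing K) A ϖ ^ (N + 1) ∣ algebraMap (IntegerRing K) A ϖ * a) :
    algebraMap (IntegerRing K) A ϖ ^ N ∣ a := by
  obtain ⟨z, hz⟩ := h
  refine ⟨z, sub_eq_zero.1 (hA _ ?_)⟩
  rw [mul_sub, hz]
  ring

theorem flatPresentation_toHom (hA : TorsionFree ϖ A) :
    FlatPresentation ϖ (P.toHom : Tdag (IntegerRing K) P.n →+* A) where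
  surj := P.surjective
  tors N b h := by
    have : (P.toHom : Tdag (IntegerRing K) P.n →+* A) (cst P.n ϖ) =
      algebraMap (IntegerRing K) A ϖ := AlgHom.commutes _ _
    rw [this] at h ⊢
    exact hA.dvd h

/-- Localization preserves flatness modulo powers of `ϖ`. -/
theorem flatPresentation_rep (hϖ : IsUnif ϖ) (hA : TorsionFree ϖ A) (f : A) :
    FlatPresentation ϖ (Loc.rep P f) where
  surj := Loc.rep_surjective P f
  tors N b h := by
    rw [Loc.rep_cst] at h ⊢
    obtain ⟨m, a, hab⟩ := Loc.exists_pow_mul_sub_dvd P hϖ b (N + 1)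
    have h1 : Loc.unif P f ϖ ^ (N + 1) ∣
        algebraMap A (Loc P f) (algebraMap (IntegerRing K) A ϖ * a) := by
      have h2 := (h.mul_left (algebraMap A (Loc P f) f ^ m)).sub
        (hab.mul_left (Loc.unif P f ϖ))
      convert h2 using 1
      rw [map_mul]
      ring
    obtain ⟨m', hm'⟩ := Loc.exists_pow_mul_dvd P hϖ h1
    have h3 : algebraMap (IntegerRing K) A ϖ ^ N ∣ f ^ m' * a :=
      hA.dvd (by rwa [mul_left_comm])
    have h4 := map_dvd (algebraMap A (Loc P f)) h3
    rw [map_pow, map_mul, map_pow] at h4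
    have hu := (Loc.isUnit_algebraMap P f).pow m
    have hu' := (Loc.isUnit_algebraMap P f).pow m'
    refine hu.dvd_mul_left.1 (hu'.dvd_mul_left.1 ?_)
    have h5 := h4.add (((pow_dvd_pow _ N.le_succ).trans hab).mul_left
      (algebraMap A (Loc P f) f ^ m'))
    convert h5 using 1
    ring

theorem Loc.res_unif {f g : A} (h : f ∣ g) : Loc.res P h (Loc.unif P f ϖ) = Loc.unif P g ϖ :=
  AlgHom.commutes _ _

/-- An element of `A⟨f⁻¹⟩†` that vanishes in `A⟨g⁻¹⟩† / ϖ^N` is killed modulo `ϖ^N` by a power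
of `g`. -/
theorem Loc.exists_pow_mul_dvd_of_res (hϖ : IsUnif ϖ) {f g : A} (hfg : f ∣ g) {b : Loc P f} {N : ℕ}
    (h : Loc.unif P g ϖ ^ N ∣ Loc.res P hfg b) :
    ∃ m, Loc.unif P f ϖ ^ N ∣ algebraMap A (Loc P f) g ^ m * b := by
  obtain ⟨m, a, hab⟩ := Loc.exists_pow_mul_sub_dvd P hϖ b N
  have h1 := map_dvd (Loc.res P hfg) hab
  rw [map_sub, map_mul, map_pow, map_pow, Loc.res_unif, AlgHom.commutes, AlgHom.commutes] at h1
  obtain ⟨m', hm'⟩ := Loc.exists_pow_mul_dvd P hϖ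
    ((dvd_sub_right (h.mul_left (algebraMap A (Loc P g) f ^ m))).1 h1)
  have h4 := map_dvd (algebraMap A (Loc P f)) hm'
  rw [map_pow, map_mul, map_pow] at h4
  have h5 := h4.add (hab.mul_left (algebraMap A (Loc P f) g ^ m'))
  have h6 : Loc.unif P f ϖ ^ N ∣ algebraMap A (Loc P f) f ^ m *
      (algebraMap A (Loc P f) g ^ m' * b) := by
    convert h5 using 1
    ring
  exact ⟨m', ((Loc.isUnit_algebraMap P f).pow m).dvd_mul_left.1 h6⟩

end Localization

/-! ### Gluing -/

section Gluing

variable {K : Type*} [NormedField K] [IsUltrametricDist K] {ϖ : IntegerRing K}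

/-- A power of `∑ a_i g_i` with exponent linear in `d` is a combination of the `g_i^d`, whose
coefficients are polynomial expressions in the `a_i` and `g_i` of degree linear in `d`. -/
theorem exists_sum_pow_eq {m : ℕ} {ι : Type*} [Fintype ι] (a g : ι → Tdag (IntegerRing K) m)
    (d : ℕ) : ∃ b : ι → Tdag (IntegerRing K) m,
      (∑ i, a i * g i) ^ (Fintype.card ι * d + 1) = ∑ i, b i * g i ^ d ∧
      ∀ ρ D : ℝ, 0 < ρ → 1 ≤ D →
        (∀ i, Bd ρ D (a i : MvPowerSeries (Fin m) (IntegerRing K))) →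
        (∀ i, Bd ρ D (g i : MvPowerSeries (Fin m) (IntegerRing K))) →
        ∀ i, Bd ρ (D ^ (2 * (Fintype.card ι * d + 1)))
          (b i : MvPowerSeries (Fin m) (IntegerRing K)) := by
  classical
  set n := Fintype.card ι * d + 1
  let Q : Tdag (IntegerRing K) m → Prop := fun x => ∃ b : ι → Tdag (IntegerRing K) m,
      x = ∑ i, b i * g i ^ d ∧ ∀ ρ D : ℝ, 0 < ρ → 1 ≤ D →
        (∀ i, Bd ρ D (a i : MvPowerSeries (Fin m) (IntegerRing K))) →
        (∀ i, Bd ρ D (g i : MvPowerSeries (Fin m) (IntegerRing K))) →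
        ∀ i, Bd ρ (D ^ (2 * n)) (b i : MvPowerSeries (Fin m) (IntegerRing K))
  have hQ0 : Q 0 := ⟨0, by simp, fun ρ D hρ hD _ _ i => Bd.zero (by positivity)⟩
  have hQadd : ∀ x y, Q x → Q y → Q (x + y) := by
    rintro x y ⟨b, rfl, hb⟩ ⟨b', rfl, hb'⟩
    refine ⟨b + b', ?_, fun ρ D hρ hD ha hg i =>
      (hb ρ D hρ hD ha hg i).add hρ.le (hb' ρ D hρ hD ha hg i)⟩
    rw [← Finset.sum_add_distrib]
    exact Finset.sum_congr rfl fun i _ => by rw [Pi.add_apply, add_mul]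
  have hQnat : ∀ (r : ℕ) x, Q x → Q (r * x) := by
    intro r x hx
    induction r with
    | zero => simpa using hQ0
    | succ r ih => rw [Nat.cast_succ, add_mul, one_mul]; exact hQadd _ _ ih hx
  change Q _
  rw [Finset.sum_pow_eq_sum_piAntidiag]
  refine Finset.sum_induction _ Q hQadd hQ0 fun k hk => hQnat _ _ ?_
  have hksum : ∑ i, k i = n := by simpa using hk
  -- by the pigeonhole principle, each monomial of degree `n` is divisible by some `g_j ^ d`
  obtain ⟨j, hj⟩ : ∃ j, d ≤ k j := by
    by_contra! hlt
    have h1 : ∑ i, k i ≤ ∑ _i : ι, d := Finset.sum_le_sum fun i _ => (hlt i).le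
    rw [hksum, Finset.sum_const, Finset.card_univ, smul_eq_mul] at h1
    omega
  let k' : ι → ℕ := Function.update k j (k j - d)
  have hk' : ∀ i, k i = k' i + if i = j then d else 0 := fun i => by
    by_cases h : i = j
    · subst h
      simp only [k', Function.update_self, if_true]
      omega
    · simp [k', h]
  have hprod : ∏ i, (a i * g i) ^ k i = (∏ i, a i ^ k i * g i ^ k' i) * g j ^ d := by
    have h1 : g j ^ d = ∏ i, g i ^ (if i = j then d else 0) := by
      simp [Finset.prod_ite_eq', pow_ite]
    rw [h1, ← Finset.prod_mul_distrib]
    refine Finset.prod_congr rfl fun i _ => ?_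
    nth_rewrite 1 [mul_pow]
    nth_rewrite 2 [hk' i]
    rw [pow_add, mul_assoc]
  refine ⟨fun i => if i = j then ∏ i, a i ^ k i * g i ^ k' i else 0, ?_, ?_⟩
  · simp only [ite_mul, zero_mul]
    rw [Finset.sum_ite_eq' Finset.univ j, if_pos (Finset.mem_univ j), hprod]
  · intro ρ D hρ hD ha hg i
    have hD0 : 0 ≤ D := by linarith
    by_cases hij : i = j
    · simp only [hij, if_true]
      have hbd : ∀ s : Finset ι, Bd ρ (D ^ (∑ i ∈ s, (k i + k' i)))
          ((∏ i ∈ s, a i ^ k i * g i ^ k' i : Tdag (IntegerRing K) m) :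
            MvPowerSeries (Fin m) (IntegerRing K)) := by
        intro s
        induction s using Finset.induction_on with
        | empty => simpa using Bd.one
        | insert i s hi ih =>
          rw [Finset.prod_insert hi, Finset.sum_insert hi, pow_add, pow_add]
          simp only [MulMemClass.coe_mul, SubmonoidClass.coe_pow]
          exact (((ha i).pow hρ hD0 _).mul hρ (by positivity) (by positivity)
            ((hg i).pow hρ hD0 _)).mul hρ (by positivity) (by positivity) ih
      refine (hbd Finset.univ).mono hρ.le le_rfl (pow_le_pow_right₀ hD ?_)
      rw [Finset.sum_add_distrib, hksum, two_mul]
      refine Nat.add_le_add_left ?_ _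
      rw [← hksum]
      exact Finset.sum_le_sum fun i _ => by rw [hk' i]; exact Nat.le_add_right _ _
    · simp only [hij, if_false]
      exact Bd.zero (by positivity)

theorem exists_one_lt_pow_le (κ : ℕ) {E : ℝ} (hE : 1 < E) : ∃ D : ℝ, 1 < D ∧ D ^ κ ≤ E := by
  have h : Filter.Tendsto (fun x : ℝ => x ^ κ) (nhdsWithin 1 (Set.Ioi 1)) (nhds 1) := by
    have := ((continuous_pow κ).tendsto (1 : ℝ)).mono_left
      (nhdsWithin_le_nhds (s := Set.Ioi (1 : ℝ)))
    simpa using this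
  obtain ⟨D, h1, h2⟩ := ((h.eventually (gt_mem_nhds hE)).and self_mem_nhdsWithin).exists
  exact ⟨D, h2, h1.le⟩

variable {A : Type*} [CommRing A] [Algebra (IntegerRing K) A] (P : Presentation K A)

include P in
/-- The `g`-torsion of `A / ϖ^N` is killed by a power of `g` whose exponent is linear in `N`. -/
theorem exists_torsion_bound (hϖ : IsUnif ϖ) (hA : TorsionFree ϖ A) (g : A) :
    ∃ e₀ : ℕ, ∀ e, e₀ ≤ e → ∀ (N m : ℕ) (a : A),
      algebraMap (IntegerRing K) A ϖ ^ N ∣ g ^ m * a →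
        algebraMap (IntegerRing K) A ϖ ^ N ∣ g ^ (e * N) * a := by
  set w := algebraMap (IntegerRing K) A ϖ
  have hcst : P.toHom (cst P.n ϖ) = w := AlgHom.commutes _ _
  let I : ℕ →o Ideal (Tdag (IntegerRing K) P.n) :=
    { toFun := fun m =>
        { carrier := {F | w ∣ g ^ m * P.toHom F}
          zero_mem' := by simp
          add_mem' := fun {F G} hF hG => by
            simp only [Set.mem_ofPred_eq, map_add, mul_add] at *
            exact dvd_add hF hG
          smul_mem' := fun c F hF => by
            simp only [Set.mem_ofPred_eq, smul_eq_mul, map_mul] at *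
            rw [mul_left_comm]
            exact hF.mul_left _ }
      monotone' := fun m m' h F (hF : w ∣ g ^ m * P.toHom F) => by
        change w ∣ g ^ m' * P.toHom F
        rw [← Nat.sub_add_cancel h, pow_add, mul_assoc]
        exact hF.mul_left _ }
  obtain ⟨e₀, he₀⟩ := exists_stabilizes hϖ I (by
    change w ∣ g ^ 0 * P.toHom (cst P.n ϖ)
    rw [hcst]
    exact dvd_mul_left _ _)
  have hone : ∀ e, e₀ ≤ e → ∀ m a, w ∣ g ^ m * a → w ∣ g ^ e * a := by
    intro e he m a h
    obtain ⟨F, rfl⟩ := P.surjective a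
    have h1 : F ∈ I (max m e) := I.mono (le_max_left m e) h
    exact I.mono he (he₀ _ (he.trans (le_max_right m e)) h1)
  refine ⟨e₀, fun e he N => ?_⟩
  induction N with
  | zero => simp
  | succ N ih =>
    intro m a h
    obtain ⟨b, hb⟩ := hone e he m a ((dvd_pow_self _ (by omega)).trans h)
    have h1 : w ^ N ∣ g ^ m * b := by
      refine hA.dvd ?_
      have h2 := h.mul_left (g ^ e)
      convert h2 using 1
      linear_combination -g ^ m * hb
    obtain ⟨z, hz⟩ := ih m b h1
    refine ⟨z, ?_⟩
    rw [mul_add, mul_one, pow_add]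
    linear_combination g ^ (e * N) * hb + w * hz

/-- If powers of elements `g_i` generating the unit ideal kill `b` modulo `c`, then `c` divides
`b`. -/
theorem dvd_of_forall_pow_mul {B ι : Type*} [CommRing B] [Fintype ι] {a g : ι → B} {b c : B}
    (h1 : ∑ i, a i * g i = 1) (h : ∀ i, ∃ m : ℕ, c ∣ g i ^ m * b) : c ∣ b := by
  let J : Ideal B := (Ideal.span {c}).colon {b}
  have hJ : ∀ x, x ∈ J ↔ c ∣ x * b := fun x => by
    rw [Submodule.mem_colon_singleton, smul_eq_mul, Ideal.mem_span_singleton]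
  have hmem : ∀ i, g i ∈ J.radical := fun i => by
    obtain ⟨m, hm⟩ := h i
    exact ⟨m, (hJ _).2 hm⟩
  have hone : (1 : B) ∈ J.radical := by
    rw [← h1]
    exact Ideal.sum_mem _ fun i _ => Ideal.mul_mem_left _ _ (hmem i)
  obtain ⟨m, hm⟩ := hone
  simpa using (hJ _).1 hm

/-- Sections with a common denominator are glued by multiplying the numerators `q_i` by the
coefficients of `∑ β_i γ_i = 1`. -/
theorem dvd_sum_mul_sub {B ι : Type*} [CommRing B] [Fintype ι] {β γ q : ι → B} {c σ : B} {j : ι}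
    (h1 : ∑ i, β i * γ i = 1) (hu : IsUnit (γ j)) (hσ : c ∣ γ j * σ - q j)
    (h : ∀ i, c ∣ γ j * q i - γ i * q j) : c ∣ ∑ i, β i * q i - σ := by
  have h2 : c ∣ ∑ i, β i * (γ j * q i - γ i * q j) := Finset.dvd_sum fun i _ => (h i).mul_left _
  have h3 : ∑ i, β i * (γ j * q i - γ i * q j) = γ j * ∑ i, β i * q i - q j := by
    have h4 : (∑ i, β i * γ i) * q j = q j := by rw [h1, one_mul]
    rw [Finset.sum_mul] at h4
    nth_rewrite 2 [← h4]
    rw [Finset.mul_sum, ← Finset.sum_sub_distrib]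
    exact Finset.sum_congr rfl fun i _ => by ring
  refine hu.dvd_mul_left.1 ?_
  convert (h3 ▸ h2).sub hσ using 1
  ring

/-- Let `q₁`, `q₂` be numerators modulo `ϖ^N` for the denominators `g₁^d`, `g₂^d` of sections which
agree over `g₁ g₂`. Then `q₁ / g₁^d = q₂ / g₂^d` holds in `A / ϖ^N` after clearing denominators and
multiplying by a bounded power of `g₁ g₂`. -/
theorem Loc.dvd_cross_mul_sub (hϖ : IsUnif ϖ) {g₁ g₂ : A} {s₁ : Loc P g₁} {s₂ : Loc P g₂}
    (hs : Loc.res P (dvd_mul_right g₁ g₂) s₁ = Loc.res P (dvd_mul_left g₂ g₁) s₂) {N d k : ℕ}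
    {q₁ q₂ : A}
    (h₁ : Loc.unif P g₁ ϖ ^ N ∣ algebraMap A (Loc P g₁) g₁ ^ d * s₁ - algebraMap A (Loc P g₁) q₁)
    (h₂ : Loc.unif P g₂ ϖ ^ N ∣ algebraMap A (Loc P g₂) g₂ ^ d * s₂ - algebraMap A (Loc P g₂) q₂)
    (hk : ∀ (m : ℕ) (a : A), algebraMap (IntegerRing K) A ϖ ^ N ∣ (g₁ * g₂) ^ m * a →
      algebraMap (IntegerRing K) A ϖ ^ N ∣ (g₁ * g₂) ^ k * a) :
    algebraMap (IntegerRing K) A ϖ ^ N ∣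
      g₂ ^ (d + k) * (g₁ ^ k * q₁) - g₁ ^ (d + k) * (g₂ ^ k * q₂) := by
  have h1 := map_dvd (Loc.res P (dvd_mul_right g₁ g₂)) h₁
  have h2 := map_dvd (Loc.res P (dvd_mul_left g₂ g₁)) h₂
  simp only [map_sub, map_mul, map_pow, AlgHom.commutes] at h1 h2
  rw [← hs] at h2
  set L := algebraMap A (Loc P (g₁ * g₂))
  have h3 : Loc.unif P (g₁ * g₂) ϖ ^ N ∣ L (g₂ ^ d * q₁ - g₁ ^ d * q₂) := by
    have h4 := (h2.mul_left (L g₁ ^ d)).sub (h1.mul_left (L g₂ ^ d))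
    convert h4 using 1
    simp only [map_sub, map_mul, map_pow]
    ring
  obtain ⟨m, hm⟩ := Loc.exists_pow_mul_dvd P hϖ h3
  convert hk m _ hm using 1
  ring

/-- Approximate gluing of sections. Let the `g_i` generate the unit ideal of `A⟨f⁻¹⟩†`. Sections
`s_i` over the `g_i` have modulo `ϖ^N` a common denominator `g_i^d` with `d` linear in `N`, and
multiplication by the numerators of an equation `∑ b_i g_i^d = 1` glues them modulo `ϖ^N`. The
Gauss norms grow slowly with `N`. -/
theorem exists_approx_glue (hϖ : IsUnif ϖ) (hA : TorsionFree ϖ A) {f : A}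
    {ι : Type*} [Fintype ι] (φ : ι → Tdag (IntegerRing K) P.n) (hfg : ∀ i, f ∣ P.toHom (φ i))
    (x : ι → Loc P f) (hx : ∑ i, x i * algebraMap A (Loc P f) (P.toHom (φ i)) = 1)
    (s : ∀ i, Loc P (P.toHom (φ i)))
    (hs : ∀ i j, Loc.res P (dvd_mul_right (P.toHom (φ i)) (P.toHom (φ j))) (s i) =
      Loc.res P (dvd_mul_left (P.toHom (φ j)) (P.toHom (φ i))) (s j)) :
    ∃ S : ℕ → Tdag (IntegerRing K) (P.n + 1),
      (∀ N j, Loc.unif P (P.toHom (φ j)) ϖ ^ N ∣ Loc.res P (hfg j) (Loc.rep P f (S N)) - s j) ∧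
      ∀ E : ℝ, 1 < E → ∃ ρ : ℝ, 1 < ρ ∧ ∃ C : ℝ, ∀ N, Bd ρ (C * E ^ N)
        (S N : MvPowerSeries (Fin (P.n + 1)) (IntegerRing K)) := by
  choose F hF using fun i => Loc.rep_surjective P _ (s i)
  choose a ha using fun i => Loc.rep_surjective P _ (x i)
  choose c₀ hc₀ using fun i => exists_pow_dvd_xiCoeff hϖ (F i)
  choose e₀ he₀ using fun p : ι × ι =>
    exists_torsion_bound P hϖ hA (P.toHom (φ p.1) * P.toHom (φ p.2))
  set c := Finset.univ.sup c₀
  set e := Finset.univ.sup e₀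
  have hc := fun i => hc₀ i c (Finset.le_sup (Finset.mem_univ i))
  have he := fun p => he₀ p e (Finset.le_sup (Finset.mem_univ p))
  let q : ℕ → ι → Tdag (IntegerRing K) P.n := fun N i => numerator (φ i) (c * (N + 1)) (F i)
  let d : ℕ → ℕ := fun N => c * (N + 1) + e * N
  have hq : ∀ N i, Loc.unif P (P.toHom (φ i)) ϖ ^ N ∣
      algebraMap A (Loc P (P.toHom (φ i))) (P.toHom (φ i)) ^ (c * (N + 1)) * s i -
        algebraMap A (Loc P (P.toHom (φ i))) (P.toHom (q N i)) := fun N i => by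
    rw [← hF i]
    exact Loc.dvd_pow_mul_sub_numerator P hϖ (φ i) (hc i N)
  choose b hbsum hbbd using fun N => exists_sum_pow_eq a (fun i => incl K P.n (φ i)) (d N)
  have hone : Loc.rep P f (∑ i, a i * incl K P.n (φ i)) = 1 := by
    rw [← hx, map_sum]
    exact Finset.sum_congr rfl fun i _ => by rw [map_mul, ha, Loc.rep_incl]
  refine ⟨fun N => ∑ i, b N i * incl K P.n (φ i ^ (e * N) * q N i), fun N j => ?_,
    fun E hE => ?_⟩
  · set L := algebraMap A (Loc P (P.toHom (φ j)))
    have h1 : ∑ i, Loc.res P (hfg j) (Loc.rep P f (b N i)) * L (P.toHom (φ i)) ^ d N = 1 := by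
      have := congrArg (fun y => Loc.res P (hfg j) (Loc.rep P f y)) (hbsum N)
      simp only [map_pow, hone, one_pow, map_one, map_sum, map_mul, Loc.rep_incl,
        AlgHom.commutes] at this
      exact this.symm
    have h2 : Loc.res P (hfg j) (Loc.rep P f (∑ i, b N i * incl K P.n (φ i ^ (e * N) * q N i))) =
        ∑ i, Loc.res P (hfg j) (Loc.rep P f (b N i)) *
          L (P.toHom (φ i) ^ (e * N) * P.toHom (q N i)) := by
      rw [map_sum, map_sum]
      refine Finset.sum_congr rfl fun i _ => ?_
      rw [map_mul, map_mul, Loc.rep_incl, AlgHom.commutes, map_mul P.toHom, map_pow P.toHom]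
    rw [h2]
    refine dvd_sum_mul_sub h1 ((Loc.isUnit_algebraMap P _).pow _) ?_ fun i => ?_
    · convert (hq N j).mul_left (L (P.toHom (φ j)) ^ (e * N)) using 1
      simp only [d, map_mul, map_pow]
      ring
    · have h3 := map_dvd L (Loc.dvd_cross_mul_sub P hϖ (hs i j) (hq N i) (hq N j)
        (fun m a => he (i, j) N m a))
      rwa [map_sub, map_mul, map_mul L (P.toHom (φ i) ^ (c * (N + 1) + e * N)), map_pow, map_pow,
        map_pow] at h3
  set κ := 2 * (Fintype.card ι * (c + e) + 1) + (e + c)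
  obtain ⟨D, hD, hDE⟩ := exists_one_lt_pow_le κ hE
  have hD0 : 0 ≤ D := by linarith
  obtain ⟨ρ₁, hρ₁, haρ⟩ := exists_common_bd a hD
  obtain ⟨ρ₂, hρ₂, hφρ⟩ := exists_common_bd φ hD
  obtain ⟨ρ₃, hρ₃, hFρ⟩ := exists_common_bd F one_lt_two
  set ρ := min ρ₁ (min ρ₂ ρ₃)
  have hρ : 1 < ρ := lt_min hρ₁ (lt_min hρ₂ hρ₃)
  have h0 : 0 < ρ := by linarith
  have haD := fun i => (haρ i).mono h0.le (min_le_left _ _) le_rfl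
  have hφD := fun i => (hφρ i).mono h0.le ((min_le_right _ _).trans (min_le_left _ _)) le_rfl
  have hF2 := fun i => (hFρ i).mono h0.le ((min_le_right _ _).trans (min_le_right _ _)) le_rfl
  refine ⟨ρ, hρ, 2 * E, fun N => ?_⟩
  rw [AddSubmonoidClass.coe_finsetSum]
  refine Bd.sum h0.le (by positivity) _ _ fun i _ => ?_
  have hqbd : Bd ρ (D ^ (e * N) * (2 * D ^ (c * (N + 1))))
      ((φ i ^ (e * N) * q N i : Tdag (IntegerRing K) P.n) :
        MvPowerSeries (Fin P.n) (IntegerRing K)) := by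
    rw [MulMemClass.coe_mul, SubmonoidClass.coe_pow]
    exact ((hφD i).pow h0 hD0 _).mul h0 (by positivity) (by positivity)
      (bd_numerator hρ.le zero_le_two hD.le (hφD i) (hF2 i) _)
  rw [MulMemClass.coe_mul]
  refine ((hbbd N ρ D h0 hD.le haD (fun i => bd_C hD0 (hφD i)) i).mul h0 (by positivity)
    (by positivity) (bd_C (by positivity) hqbd)).mono h0.le le_rfl ?_
  calc D ^ (2 * (Fintype.card ι * d N + 1)) * (D ^ (e * N) * (2 * D ^ (c * (N + 1))))
      = 2 * D ^ (2 * (Fintype.card ι * d N + 1) + (e * N + c * (N + 1))) := by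
        rw [pow_add, pow_add]; ring
    _ ≤ 2 * D ^ (κ * (N + 1)) := by
        have hle : 2 * (Fintype.card ι * d N + 1) + (e * N + c * (N + 1)) ≤ κ * (N + 1) := by
          simp only [κ, d]
          nlinarith [Nat.zero_le (Fintype.card ι * e), Nat.zero_le e, Nat.zero_le N]
        gcongr
        exact hD.le
    _ ≤ 2 * E ^ (N + 1) := by
        rw [pow_mul]
        gcongr
    _ = 2 * E * E ^ N := by ring

theorem IsUnif.exists_between (hϖ : IsUnif ϖ) : ∃ E : ℝ, 1 < E ∧ E * ‖ϖ‖ < 1 := by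
  obtain ⟨E, hE1, hE2⟩ := _root_.exists_between ((one_lt_inv₀ hϖ.pos).2 hϖ.lt_one)
  exact ⟨E, hE1, by rwa [← lt_div_iff₀ hϖ.pos, one_div]⟩

/-- Compatible sections of `A⟨g_i⁻¹⟩†` glue to a section of `A⟨f⁻¹⟩†`, provided that the multiples
`g_i` of `f` generate the unit ideal of `A⟨f⁻¹⟩†`: the approximate solutions converge. -/
theorem exists_glue [CompleteSpace K] (hϖ : IsUnif ϖ) (hA : TorsionFree ϖ A) {f : A}
    {ι : Type*} [Fintype ι] (g : ι → A) (hfg : ∀ i, f ∣ g i) (x : ι → Loc P f)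
    (hx : ∑ i, x i * algebraMap A (Loc P f) (g i) = 1) (s : ∀ i, Loc P (g i))
    (hs : ∀ i j, Loc.res P (dvd_mul_right (g i) (g j)) (s i) =
      Loc.res P (dvd_mul_left (g j) (g i)) (s j)) :
    ∃ S : Loc P f, ∀ i, Loc.res P (hfg i) S = s i := by
  choose φ hφ using fun i => P.surjective (g i)
  obtain rfl : (fun i => P.toHom (φ i)) = g := funext hφ
  obtain ⟨S, hres, hSbd⟩ := exists_approx_glue P hϖ hA φ hfg x hx s hs
  have hcauchy : ∀ N, Loc.rep P f (cst _ ϖ) ^ N ∣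
      Loc.rep P f (S (N + 1)) - Loc.rep P f (S N) := by
    intro N
    rw [Loc.rep_cst]
    refine dvd_of_forall_pow_mul hx fun j => Loc.exists_pow_mul_dvd_of_res P hϖ (hfg j) ?_
    have h1 := ((pow_dvd_pow _ N.le_succ).trans (hres (N + 1) j)).sub (hres N j)
    rw [map_sub]
    convert h1 using 1
    exact (sub_sub_sub_cancel_right _ _ _).symm
  obtain ⟨E, hE1, hEϖ⟩ := hϖ.exists_between
  obtain ⟨ρ, hρ, C, hC⟩ := hSbd E hE1
  obtain ⟨T, hT⟩ := (flatPresentation_rep P hϖ hA f).exists_limit hϖ S hρ hE1.le hEϖ hC hcauchy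
  refine ⟨T, fun j => sub_eq_zero.1 ((flatPresentation_rep P hϖ hA _).eq_zero_of_forall_pow_dvd hϖ
    fun N => ?_)⟩
  have h1 := hT N
  rw [Loc.rep_cst] at h1 ⊢
  have h2 := map_dvd (Loc.res P (hfg j)) h1
  rw [map_pow, Loc.res_unif, map_sub] at h2
  convert h2.add (hres N j) using 1
  exact (sub_add_sub_cancel _ _ _).symm

/-- `A → A⟨1⁻¹⟩†` is an isomorphism: substitute `ξ = 1`. -/
theorem Loc.algebraMap_bijective_of_eq_one [CompleteSpace K] (hϖ : IsUnif ϖ)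
    (hA : TorsionFree ϖ A) {f : A} (hf : f = 1) :
    Function.Bijective (algebraMap A (Loc P f)) := by
  have hcst : (P.toHom : Tdag (IntegerRing K) P.n →+* A) (cst P.n ϖ) =
    algebraMap (IntegerRing K) A ϖ := AlgHom.commutes _ _
  have hdvd : ∀ (N : ℕ) (a : A), Loc.unif P f ϖ ^ N ∣ algebraMap A (Loc P f) a →
      algebraMap (IntegerRing K) A ϖ ^ N ∣ a := fun N a h => by
    obtain ⟨m, hm⟩ := Loc.exists_pow_mul_dvd P hϖ h
    rwa [hf, one_pow, one_mul] at hm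
  constructor
  · rw [injective_iff_map_eq_zero]
    intro a ha
    refine (flatPresentation_toHom P hA).eq_zero_of_forall_pow_dvd hϖ fun N => ?_
    rw [hcst]
    exact hdvd N a (by rw [ha]; exact dvd_zero _)
  · intro b
    obtain ⟨φ, rfl⟩ := P.surjective f
    obtain ⟨F, rfl⟩ := Loc.rep_surjective P _ b
    obtain ⟨c, hc⟩ := exists_pow_dvd_xiCoeff hϖ F
    let S : ℕ → Tdag (IntegerRing K) P.n := fun N => numerator φ (c * (N + 1)) F
    have hS : ∀ N, Loc.unif P (P.toHom φ) ϖ ^ N ∣ Loc.rep P (P.toHom φ) F -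
        algebraMap A (Loc P (P.toHom φ)) (P.toHom (S N)) := fun N => by
      have h := Loc.dvd_pow_mul_sub_numerator P hϖ φ (hc c le_rfl N)
      have h1 : algebraMap A (Loc P (P.toHom φ)) (P.toHom φ) = 1 := by
        exact (congrArg _ hf).trans (map_one _)
      rwa [h1, one_pow, one_mul] at h
    obtain ⟨E, hE1, hEϖ⟩ := hϖ.exists_between
    obtain ⟨D, hD, hDE⟩ := exists_one_lt_pow_le c hE1
    obtain ⟨ρ₁, hρ₁, hφρ⟩ := IsOverconvergent.exists_bd_lt norm_le_one φ.2 hD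
    obtain ⟨ρ₂, C, hρ₂, hC, hFρ⟩ := IsOverconvergent.exists_bd F.2
    have hρ : 1 < min ρ₁ ρ₂ := lt_min hρ₁ hρ₂
    have h0 : 0 ≤ min ρ₁ ρ₂ := by linarith
    obtain ⟨a, ha⟩ := (flatPresentation_toHom P hA).exists_limit hϖ S (C := C * E) hρ hE1.le hEϖ
      (fun N => (bd_numerator hρ.le hC hD.le (hφρ.mono h0 (min_le_left _ _) le_rfl)
        (hFρ.mono h0 (min_le_right _ _) le_rfl) _).mono h0 le_rfl (by
          rw [mul_assoc, ← pow_succ', pow_mul]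
          gcongr)) fun N => by
        rw [hcst]
        refine hdvd N _ ?_
        have h1 := (hS N).sub ((pow_dvd_pow _ N.le_succ).trans (hS (N + 1)))
        convert h1 using 1
        simp
    refine ⟨a, sub_eq_zero.1 ((flatPresentation_rep P hϖ hA _).eq_zero_of_forall_pow_dvd hϖ
      fun N => ?_)⟩
    rw [Loc.rep_cst]
    have h1 := ha N
    rw [hcst] at h1
    have h2 := map_dvd (algebraMap A (Loc P (P.toHom φ))) h1
    rw [map_pow, map_sub] at h2
    convert h2.sub (hS N) using 1
    simp

end Gluing

/-! ### Points, and sections of the structure sheaf -/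

section Sections

variable {K : Type*} [NormedField K] [IsUltrametricDist K] {ϖ : IntegerRing K}
variable {A : Type*} [CommRing A] [Algebra (IntegerRing K) A] (P : Presentation K A)

theorem mem_basicOpen_iff {x : SpfSpace K A} {f : A} :
    x ∈ basicOpen K f ↔ reduction K f ∉ x.asIdeal := Iff.rfl

/-- A prime ideal of `A` that contains `ϖ` is a point of `Spec (A ⊗ k)`: the kernel of
`A ⊗ k → A / 𝔮`. -/
theorem exists_point (hϖ : IsUnif ϖ) (𝔮 : Ideal A) [𝔮.IsPrime]
    (h : algebraMap (IntegerRing K) A ϖ ∈ 𝔮) :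
    ∃ x : SpfSpace K A, ∀ f : A, x ∈ basicOpen K f ↔ f ∉ 𝔮 := by
  let ψ : IsLocalRing.ResidueField (IntegerRing K) →ₐ[IntegerRing K] A ⧸ 𝔮 :=
    Ideal.Quotient.liftₐ (IsLocalRing.maximalIdeal (IntegerRing K))
      (Algebra.ofId (IntegerRing K) (A ⧸ 𝔮)) fun r hr => by
        obtain ⟨r', rfl⟩ := hϖ.mem_maximalIdeal_iff.1 hr
        change algebraMap (IntegerRing K) (A ⧸ 𝔮) (ϖ * r') = 0
        rw [IsScalarTower.algebraMap_apply (IntegerRing K) A, Ideal.Quotient.algebraMap_eq,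
          Ideal.Quotient.eq_zero_iff_mem, map_mul]
        exact 𝔮.mul_mem_right _ h
  let Φ : A ⊗[IntegerRing K] IsLocalRing.ResidueField (IntegerRing K) →ₐ[IntegerRing K] A ⧸ 𝔮 :=
    Algebra.TensorProduct.lift (Ideal.Quotient.mkₐ (IntegerRing K) 𝔮) ψ fun _ _ => mul_comm _ _
  refine ⟨⟨RingHom.ker Φ, RingHom.ker_isPrime Φ⟩, fun f => ?_⟩
  have hΦ : Φ (reduction K f) = Ideal.Quotient.mk 𝔮 f := by
    refine (Algebra.TensorProduct.lift_tmul _ _ _ _ _).trans ?_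
    rw [map_one, mul_one, Ideal.Quotient.mkₐ_eq_mk]
  rw [mem_basicOpen_iff, RingHom.mem_ker, hΦ, Ideal.Quotient.eq_zero_iff_mem]

variable (K A) in
/-- The reduction `A → A ⊗ k` as a ring homomorphism. -/
def reductionHom : A →+* A ⊗[IntegerRing K] IsLocalRing.ResidueField (IntegerRing K) :=
  Algebra.TensorProduct.includeLeftRingHom

theorem reductionHom_apply (f : A) : reductionHom K A f = reduction K f := rfl

theorem reduction_unif_mul (hϖ : IsUnif ϖ) (a : A) :
    reduction K (algebraMap (IntegerRing K) A ϖ * a) = 0 := by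
  have h : (algebraMap (IntegerRing K) (IsLocalRing.ResidueField (IntegerRing K)) ϖ) = 0 :=
    (residue_eq_zero_iff hϖ).2 dvd_rfl
  rw [reduction, ← Algebra.smul_def, TensorProduct.smul_tmul, ← Algebra.algebraMap_eq_smul_one, h,
    TensorProduct.tmul_zero]

/-- If the elements of an ideal `I` containing a power of `ϖ` have no common zero in `X_f̄`,
then `I` contains a power of `f`. -/
theorem exists_pow_mem (hϖ : IsUnif ϖ) (I : Ideal A) {N : ℕ}
    (hI : algebraMap (IntegerRing K) A ϖ ^ N ∈ I) {f : A}
    (h : ∀ x ∈ basicOpen K f, ∃ a ∈ I, x ∈ basicOpen K a) : ∃ m, f ^ m ∈ I := by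
  by_contra! hf
  obtain ⟨𝔮, h𝔮, hI𝔮, hdisj⟩ := Ideal.exists_le_prime_disjoint I (Submonoid.powers f)
    (Set.disjoint_left.2 fun y hy ⟨m, hm⟩ => hf m (by subst hm; exact hy))
  obtain ⟨x, hx⟩ := exists_point hϖ 𝔮 (h𝔮.mem_of_pow_mem N (hI𝔮 hI))
  obtain ⟨a, ha, hxa⟩ := h x ((hx f).2 fun hf𝔮 =>
    Set.disjoint_left.1 hdisj hf𝔮 (Submonoid.mem_powers f))
  exact (hx a).1 hxa (hI𝔮 ha)

theorem exists_res_eq_zero_of_germ_eq_zero {f : A} {x : SpfSpace K A} (hx : x ∈ basicOpen K f)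
    {a : Loc P f} (h : germ P f x hx a = 0) :
    ∃ (g : A) (hfg : f ∣ g), x ∈ basicOpen K g ∧ Loc.res P hfg a = 0 := by
  have h' : germ P f x hx a = germ P f x hx 0 := by rw [h, map_zero]
  obtain ⟨⟨g, hg⟩, h1, h2, h3⟩ := Quotient.exact h'
  refine ⟨g, h1, hg, ?_⟩
  have h4 : Loc.res P h1 a = Loc.res P h2 0 := h3
  rw [h4, map_zero]

/-- A section all of whose germs vanish is zero. -/
theorem toSections_injective [CompleteSpace K] (hϖ : IsUnif ϖ) (hA : TorsionFree ϖ A) (f : A) :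
    Function.Injective (toSections P f) := by
  rw [injective_iff_map_eq_zero]
  intro a ha
  refine (flatPresentation_rep P hϖ hA f).eq_zero_of_forall_pow_dvd hϖ fun N => ?_
  rw [Loc.rep_cst]
  -- the annihilator of `a` modulo `ϖ^N`
  let I : Ideal A := ((Ideal.span {Loc.unif P f ϖ ^ N}).colon {a}).comap (algebraMap A (Loc P f))
  have hI : ∀ c, c ∈ I ↔ Loc.unif P f ϖ ^ N ∣ algebraMap A (Loc P f) c * a := fun c => by
    rw [Ideal.mem_comap, Submodule.mem_colon_singleton, smul_eq_mul, Ideal.mem_span_singleton]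
  obtain ⟨m, hm⟩ := exists_pow_mem hϖ I (N := N) (f := f)
    ((hI _).2 (by rw [map_pow]; exact dvd_mul_right _ _)) fun x hx => by
      have hgerm : germ P f x hx a = 0 := congrFun (congrArg Subtype.val ha) ⟨x, hx⟩
      obtain ⟨g, hfg, hxg, hres⟩ := exists_res_eq_zero_of_germ_eq_zero P hx hgerm
      obtain ⟨m, hm⟩ := Loc.exists_pow_mul_dvd_of_res P hϖ hfg (b := a) (N := N)
        (by rw [hres]; exact dvd_zero _)
      refine ⟨g ^ m, (hI _).2 (by rwa [map_pow]), ?_⟩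
      rw [mem_basicOpen_iff] at hxg ⊢
      rw [← reductionHom_apply, map_pow]
      exact fun h => hxg (x.2.mem_of_pow_mem m h)
  rw [hI, map_pow] at hm
  exact ((Loc.isUnit_algebraMap P f).pow m).dvd_mul_left.1 hm

/-- Every section over `X_f̄` comes from `A⟨f⁻¹⟩†`. -/
theorem toSections_surjective [CompleteSpace K] (hϖ : IsUnif ϖ) (hA : TorsionFree ϖ A) (f : A) :
    Function.Surjective (toSections P f) := by
  intro s
  choose h hxh a ha using s.2
  -- finitely many of the `h x` generate a power of `f` modulo `ϖ`
  obtain ⟨r, hr⟩ := exists_pow_mem hϖ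
    (Ideal.span (Set.range h) ⊔ Ideal.span {algebraMap (IntegerRing K) A ϖ}) (N := 1) (f := f)
    (by
      rw [pow_one]
      exact Ideal.mem_sup_right (Ideal.mem_span_singleton_self _))
    fun x hx => ⟨h ⟨x, hx⟩, Ideal.mem_sup_left (Ideal.subset_span ⟨_, rfl⟩), hxh ⟨x, hx⟩⟩
  obtain ⟨y, hy, z, hz, hyz⟩ := Submodule.mem_sup.1 hr
  obtain ⟨z, rfl⟩ := Ideal.mem_span_singleton.1 hz
  obtain ⟨l, rfl⟩ := (Finsupp.mem_ideal_span_range_iff_exists_finsupp).1 hy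
  let ι := {x // x ∈ l.support}
  let g : ι → A := fun i => f * h i
  have hsum : ∑ i : ι, l i * h i + algebraMap (IntegerRing K) A ϖ * z = f ^ r := by
    rw [← hyz, Finsupp.sum]
    congr 1
    exact Finset.sum_coe_sort l.support fun x => l x * h x
  have hcover : ∀ x ∈ basicOpen K f, ∃ i : ι, x ∈ basicOpen K (g i) := by
    intro x hx
    by_contra! hc
    have hmem : ∀ i : ι, reduction K (h i) ∈ x.asIdeal := fun i => by
      by_contra hi
      exact hc i (mem_basicOpen_mul hx hi)
    refine hx (x.2.mem_of_pow_mem r ?_)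
    rw [← reductionHom_apply, ← map_pow, ← hsum, map_add, map_sum, reductionHom_apply _,
      reduction_unif_mul hϖ, add_zero]
    exact x.asIdeal.sum_mem fun i _ => by
      rw [map_mul]
      exact x.asIdeal.mul_mem_left _ (hmem i)
  let t : ∀ i, Loc P (g i) := fun i => Loc.res P (dvd_mul_left (h i) f) (a i)
  have ht : ∀ (i : ι) (y : SpfSpace K A) (hyf : y ∈ basicOpen K f) (hy : y ∈ basicOpen K (g i)),
      s.1 ⟨y, hyf⟩ = germ P (g i) y hy (t i) := fun i y hyf hy => by
    rw [germ_res P _ _ (mem_basicOpen_mul_iff.1 hy).2]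
    exact ha i ⟨y, hyf⟩ (mem_basicOpen_mul_iff.1 hy).2
  -- `∑ l i * g i` is a unit of `A⟨f⁻¹⟩†`
  set L := algebraMap A (Loc P f)
  set v := Loc.mk P f (Adjoin.xi P)
  have hv : L f ^ (r + 1) * v ^ (r + 1) = 1 := by
    rw [← mul_pow, Loc.algebraMap_mul_xi, one_pow]
  have hunit := FlatPresentation.isUnit_one_add hϖ (Loc.rep_surjective P f)
    (-(L z * L f * v ^ (r + 1)))
  rw [Loc.rep_cst] at hunit
  obtain ⟨u, hu⟩ := hunit.exists_left_inv
  have hx : ∑ i : ι, (u * v ^ (r + 1) * L (l i)) * L (g i) = 1 := by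
    have h1 := congrArg L hsum
    rw [map_add, map_sum, map_mul, map_pow] at h1
    have h2 : ∑ i : ι, (u * v ^ (r + 1) * L (l i)) * L (g i) =
        u * v ^ (r + 1) * L f * ∑ i : ι, L (l i * h i) := by
      rw [Finset.mul_sum]
      exact Finset.sum_congr rfl fun i _ => by
        rw [map_mul, map_mul]
        ring
    rw [h2, ← hu]
    linear_combination (u * v ^ (r + 1) * L f) * h1 + u * hv
  obtain ⟨S, hS⟩ := exists_glue P hϖ hA g (fun i => dvd_mul_right f (h i)) _ hx t fun i j => by
    refine toSections_injective P hϖ hA (g i * g j) (Subtype.ext (funext fun y => ?_))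
    obtain ⟨hyi, hyj⟩ := mem_basicOpen_mul_iff.1 y.2
    have hyf := (mem_basicOpen_mul_iff.1 hyi).1
    change germ P _ y y.2 _ = germ P _ y y.2 _
    rw [germ_res P _ _ hyi, germ_res P _ _ hyj, ← ht i y hyf hyi, ← ht j y hyf hyj]
  refine ⟨S, Subtype.ext (funext fun y => ?_)⟩
  obtain ⟨i, hi⟩ := hcover y y.2
  change germ P f y y.2 S = _
  rw [← germ_res P (dvd_mul_right f (h i)) y y.2 hi, hS i, ← ht i y y.2 hi]

end Sections

end Dagger

end

theorem proposition7 (p : ℕ) [Fact p.Prime] (K : Type*) [NormedField K] [IsUltrametricDist K]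
    [NormedAlgebra ℚ_[p] K] [FiniteDimensional ℚ_[p] K] (A : Type*) [CommRing A]
    [Algebra (Dagger.IntegerRing K) A] [Module.Flat (Dagger.IntegerRing K) A]
    (P : Dagger.Presentation K A) :
    (∀ f : A, Function.Bijective (Dagger.toSections P f)) ∧
      Function.Bijective (algebraMap A (Dagger.structureSheaf P ⊤)) := by
  have : ProperSpace K := FiniteDimensional.proper ℚ_[p] K
  obtain ⟨ϖ, hϖ⟩ := Dagger.exists_isUnif (K := K) ⟨algebraMap ℚ_[p] K p, by
      exact (map_ne_zero _).2 (Nat.cast_ne_zero.2 (Fact.out : p.Prime).ne_zero), by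
      rw [norm_algebraMap', Padic.norm_p]
      exact inv_lt_one_of_one_lt₀ (by exact_mod_cast (Fact.out : p.Prime).one_lt)⟩
  have hA : Dagger.TorsionFree ϖ A := fun a ha => by
    rw [← Algebra.smul_def] at ha
    exact (smul_eq_zero.1 ha).resolve_left hϖ.ne_zero
  have hbij : ∀ f : A, Function.Bijective (Dagger.toSections P f) := fun f =>
    ⟨Dagger.toSections_injective P hϖ hA f, Dagger.toSections_surjective P hϖ hA f⟩
  refine ⟨hbij, ?_⟩
  have htop : Dagger.basicOpen K (1 : A) = ⊤ := by
    rw [Dagger.basicOpen, Dagger.reduction_one, PrimeSpectrum.basicOpen_one]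
  rw [← htop]
  have h := (hbij 1).comp (Dagger.Loc.algebraMap_bijective_of_eq_one P hϖ hA rfl)
  convert h using 1
  exact funext fun a => ((Dagger.toSections P 1).commutes a).symm
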